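/- **Setting.** Let $p\in(1,\infty)$, $c\in(1,2]$, and let $(G,d)$ be a complete $p$-uniformly convex space with constant $c$: a geodesic space with $$d(z,(1-t)x\oplus ty)^p\le (1-t)d(z,x)^p+t\,d(z,y)^p-\tfrac c2 t(1-t)d(x,y)^p\quad(t\in[0,1],\ x,y,z\in G).$$ Let $f,g:G\to\mathbb R\cup\{+\infty\}$ be proper, (geodesically) convex and lower semicontinuous with $\operatorname{argmin} f\cap\operatorname{argmin} g\neq\emptyset$. For $\lambda>0$ let $\operatorname{prox}^p_{f,\lambda}(x)=\operatorname{argmin}_{y\in G}\, f(y)+\frac1{p\lambda^{p-1}}d(y,x)^p$, and for $\beta\in(0,1]$ let $\beta T\oplus(1-\beta)\mathrm{Id}$ map $x$ to $\beta Tx\oplus(1-\beta)x$. For $T:G\to G$ and $r>0$ put $$\psi_T^{(p,r)}(x,y)=\tfrac r2\big(d(Tx,x)^p+d(Ty,y)^p+d(Tx,Ty)^p+d(x,y)^p-d(Tx,y)^p-d(x,Ty)^p\big),$$ and consider, for $\alpha\in(0,1)$ and $\epsilon\ge0$, the inequality $$(*)\qquad d(Tx,Ty)^p\le(1+\epsilon)d(x,y)^p-\tfrac{1-\alpha}{\alpha}\psi^{(p,r)}_T(x,y).$$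 $T$ is *pointwise almost $\alpha$-firmly nonexpansive at $y\in D$ on $D\subset G$ with constant $\alpha\in(0,1)$ and violation $\epsilon\ge 0$* if $(*)$ with $r=c$ holds for all $x\in D$. $T$ is *pointwise asymptotically $\alpha$-firmly nonexpansive at $y$ with constant $\alpha\in(0,1)$, with respect to $r$* if for every $\epsilon>0$ there is a neighborhood $D_\epsilon$ of $y$ such that $(*)$ holds for all $x\in D_\epsilon$; when $r$ is not mentioned, $r=c$. A space is *symmetric perpendicular* if for all geodesics $\gamma,\eta$ with a common point $q$: $\gamma\perp_q\eta\iff\eta\perp_q\gamma$, where $\gamma\perp_q\eta$ means $d(x,q)\le d(x,y)$ for all $x\in\gamma$, $y\in\eta$. Put $$\alpha_c=\tfrac{c(c-1)}{c(c-1)+2},\qquad \epsilon_c=\tfrac{2-c}{c-1},\qquad \alpha_\beta=\tfrac{\alpha_c\beta^{p-1}}{\alpha_c\beta^{p-1}-\alpha_c\beta+1},\qquad \overline\alpha_\beta=\tfrac{\beta^{p-1}}{\beta^{p-1}-\beta+2},$$ $$A(a,b)=\frac{a+b-2ab}{\frac c2(1-a-b+ab)+a+b-2ab}.$$ The statements about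 CAT($\kappa$) spaces ($\kappa>0$) are for the exponent $p=2$, and there $r$ is an arbitrary number in $(0,2]$ (in particular $r=c$ and $r=2$ are allowed). **Proposition.** Let $\lambda,\lambda_1,\lambda_2>0$ and $\beta\in(0,1]$. 1. $T=\operatorname{prox}^p_{f,\lambda_2}\circ\operatorname{prox}^p_{g,\lambda_1}$ is pointwise almost $\alpha$-firmly nonexpansive at all $y\in\operatorname{argmin} f\cap\operatorname{argmin} g$ on $G$ with constant $\frac{2(c-1)}{2c-1}$ and violation $\frac1{(c-1)^2}-1$. If $(G,d)$ is a CAT($\kappa$) space, $T$ is pointwise asymptotically $\alpha$-firmly nonexpansive at all these $y$ with constant $\frac23$, with respect to $r$. 2. Let $T_0:G\to G$, let $\Omega=\operatorname{argmin} f\cap\operatorname{Fix}T_0$, and let $T_0$ be pointwise asymptotically $\alpha$-firmly nonexpansive with constant $\overline\alpha_0$ at all $y\in\Omega$. Let $T=\operatorname{prox}^p_{f,\lambda}\circ T_0$ and $y\in\Omega$. If $T_0$ is pointwise almost $\alpha$-firmly nonexpansive at $y$ on a set $D\subset G$ with constant $\overline\alpha_0$ and violation $\epsilon_0$, then $T$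 is pointwise almost $\alpha$-firmly nonexpansive at $y$ on $D$ with constant $A(\overline\alpha_0,\alpha_c)$ and violation $\epsilon_0+\epsilon_c+\epsilon_0\epsilon_c$; and for every $\epsilon_0>0$ there is a neighborhood $D$ of $y$ on which both hold. If $(G,d)$ is a CAT($\kappa$) space and $T_0$ is pointwise asymptotically $\alpha$-firmly nonexpansive at all $y\in\Omega$ with constant $\overline\alpha_0$, with respect to $r$, then $T$ is so at all $y\in\Omega$ with constant $\frac1{2-\overline\alpha_0}$, with respect to $r$. 3. $T=\beta\operatorname{prox}^p_{f,\lambda}\oplus(1-\beta)\mathrm{Id}$ is pointwise almost $\alpha$-firmly nonexpansive at all $y\in\operatorname{argmin} f$ on $G$ with constant $\alpha_\beta$ and violation $\beta\epsilon_c$. If $(G,d)$ is a CAT($\kappa$) space, $T$ is pointwise asymptotically $\alpha$-firmly nonexpansive at all these $y$ with constant $\overline\alpha_\beta$, with respect to $r$. 4. $T=\operatorname{prox}^p_{f,\lambda_2}\circ(\beta\operatorname{prox}^p_{g,\lambda_1}\oplus(1-\beta)\mathrm{Id})$ is pointwise almost $\alpha$-firmly nonexpansive at all $y\in\operatorname{argmin}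 f\cap\operatorname{argmin} g$ on $G$ with constant $A(\alpha_\beta,\alpha_c)$ and violation $(1+\beta)\epsilon_c+\beta\epsilon_c^2$. If $(G,d)$ is a CAT($\kappa$) space, $T$ is pointwise asymptotically $\alpha$-firmly nonexpansive at all these $y$ with constant $\frac1{2-\overline\alpha_\beta}$, with respect to $r$. 5. Let $C\subset G$ be closed and geodesically convex with metric projector $P_C$, and let $T=P_C\circ(\beta\operatorname{prox}^p_{g,\lambda}\oplus(1-\beta)\mathrm{Id})$. If $(G,d)$ is symmetric perpendicular, then $T$ is pointwise almost $\alpha$-firmly nonexpansive at all $y\in C\cap\operatorname{argmin} g$ on $G$ with constant $\frac1{\frac c2(1-\alpha_\beta)+1}$ and violation $\beta\epsilon_c$. If $(G,d)$ is a CAT($\kappa$) space, $T$ is pointwise asymptotically $\alpha$-firmly nonexpansive at all these $y$ with constant $\frac1{2-\overline\alpha_\beta}$, with respect to $r$. -/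

import Mathlib

open Set Filter Topology

noncomputable section

namespace ProxFirm

variable {G : Type*} [MetricSpace G]

/-- `γ`, restricted to `[0,1]`, is a geodesic from `x` to `y` (parametrised proportionally to
arc length). -/
def IsGeodesic (γ : ℝ → G) (x y : G) : Prop :=
  γ 0 = x ∧ γ 1 = y ∧
    ∀ s ∈ Icc (0 : ℝ) 1, ∀ t ∈ Icc (0 : ℝ) 1, dist (γ s) (γ t) = |s - t| * dist x y

/-- Any two points are joined by a geodesic. -/
def IsGeodesicSpace (G : Type*) [MetricSpace G] : Prop :=
  ∀ x y : G, ∃ γ : ℝ → G, IsGeodesic γ x y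

/-- `p`-uniformly convex spaces with constant `c`. The points `(1-t)x ⊕ ty` are the points `γ t`
of the geodesics `γ` from `x` to `y`. -/
def IsPUniformlyConvex (p c : ℝ) (G : Type*) [MetricSpace G] : Prop :=
  1 < p ∧ 0 < c ∧ IsGeodesicSpace G ∧
    ∀ (x y z : G) (γ : ℝ → G), IsGeodesic γ x y → ∀ t ∈ Icc (0 : ℝ) 1,
      dist z (γ t) ^ p ≤
        (1 - t) * dist z x ^ p + t * dist z y ^ p - c / 2 * (t * (1 - t)) * dist x y ^ p

open Classical in
/-- The geodesic convex combination `(1-t)x ⊕ ty`. In a `p`-uniformly convex space geodesics exist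
and are unique, so no choice is involved there. -/
def geoComb (t : ℝ) (x y : G) : G :=
  if h : ∃ γ : ℝ → G, IsGeodesic γ x y then h.choose t else x

/-! ### CAT(κ) spaces, `κ > 0` -/

/-- The unit sphere in Euclidean 3-space. With the angular distance divided by `√κ`, it is the
model surface of constant curvature `κ > 0`. -/
abbrev Sph : Type := Metric.sphere (0 : EuclideanSpace ℝ (Fin 3)) 1

/-- Distance of the model surface of curvature `κ > 0`. -/
def modelDist (κ : ℝ) (u v : Sph) : ℝ :=
  InnerProductGeometry.angle (u : EuclideanSpace ℝ (Fin 3)) (v : EuclideanSpace ℝ (Fin 3)) /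
    Real.sqrt κ

/-- CAT(κ) spaces for `κ > 0`: points at distance less than `π / √κ` are joined by a geodesic, and
every geodesic triangle of perimeter less than `2π / √κ` has a comparison triangle `x' y' z'` in
the model surface such that distances between points of the triangle do not exceed those
between their comparison points. (Two points on different sides of the triangle are on two sides
with a common vertex, here called `x`.) -/
def IsCAT (κ : ℝ) (G : Type*) [MetricSpace G] : Prop :=
  0 < κ ∧
  (∀ x y : G, dist x y < Real.pi / Real.sqrt κ → ∃ γ : ℝ → G, IsGeodesic γ x y) ∧
  ∀ (x y z : G) (γ η : ℝ → G), IsGeodesic γ x y → IsGeodesic η x z →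
    dist x y + dist y z + dist z x < 2 * Real.pi / Real.sqrt κ →
    ∃ x' y' z' : Sph,
      modelDist κ x' y' = dist x y ∧ modelDist κ y' z' = dist y z ∧
      modelDist κ x' z' = dist x z ∧
      ∀ s ∈ Icc (0 : ℝ) 1, ∀ t ∈ Icc (0 : ℝ) 1, ∀ u v : Sph,
        modelDist κ x' u = s * dist x y → modelDist κ u y' = (1 - s) * dist x y →
        modelDist κ x' v = t * dist x z → modelDist κ v z' = (1 - t) * dist x z →
        dist (γ s) (η t) ≤ modelDist κ u v

/-! ### Symmetric perpendicular spaces -/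

/-- Images of geodesics. -/
def IsGeodesicSet (S : Set G) : Prop :=
  ∃ (x y : G) (γ : ℝ → G), IsGeodesic γ x y ∧ S = γ '' Icc (0 : ℝ) 1

/-- `S` is perpendicular to `R` at the point `q`. -/
def Perp (S R : Set G) (q : G) : Prop :=
  ∀ x ∈ S, ∀ y ∈ R, dist x q ≤ dist x y

/-- Symmetric perpendicular spaces. -/
def IsSymmPerp (G : Type*) [MetricSpace G] : Prop :=
  ∀ (S R : Set G), IsGeodesicSet S → IsGeodesicSet R →
    ∀ q ∈ S ∩ R, (Perp S R q ↔ Perp R S q)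

/-! ### Convex functions, convex sets, proximal mappings and projectors -/

/-- Proper convex lower semicontinuous functions `G → ℝ ∪ {+∞}`. -/
def IsProperConvexLsc (f : G → EReal) : Prop :=
  (∀ x, f x ≠ ⊥) ∧ (∃ x, f x ≠ ⊤) ∧ LowerSemicontinuous f ∧
    ∀ (x y : G) (γ : ℝ → G), IsGeodesic γ x y → ∀ t ∈ Icc (0 : ℝ) 1,
      f (γ t) ≤ ((1 - t : ℝ) : EReal) * f x + (t : EReal) * f y

/-- The set of (global) minimisers of `f`. -/
def argmin (f : G → EReal) : Set G := {x | ∀ y, f x ≤ f y}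

/-- The function `y ↦ f y + d(y,x)^p / (p l^(p-1))` that defines the `p`-proximal mapping. -/
def proxObj (p l : ℝ) (f : G → EReal) (x y : G) : EReal :=
  f y + ((1 / (p * l ^ (p - 1)) * dist y x ^ p : ℝ) : EReal)

open Classical in
/-- The `p`-proximal mapping. In a complete `p`-uniformly convex space the minimiser exists and is
unique for a proper convex lower semicontinuous function that has a minimiser, so the choice and
the default value are immaterial there. -/
def prox (p l : ℝ) (f : G → EReal) (x : G) : G :=
  if h : ∃ z, z ∈ argmin (proxObj p l f x) then h.choose else x

/-- Geodesically convex sets. -/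
def IsGeodConvex (C : Set G) : Prop :=
  ∀ x ∈ C, ∀ y ∈ C, ∀ γ : ℝ → G, IsGeodesic γ x y → ∀ t ∈ Icc (0 : ℝ) 1, γ t ∈ C

open Classical in
/-- The metric projector onto `C`. In a complete `p`-uniformly convex space the nearest point exists
and is unique for a nonempty closed convex set. -/
def proj (C : Set G) (x : G) : G :=
  if h : ∃ z ∈ C, ∀ w ∈ C, dist x z ≤ dist x w then h.choose else x

/-- The Krasnoselski-Mann relaxation `βT ⊕ (1-β)Id`. -/
def km (β : ℝ) (T : G → G) (x : G) : G := geoComb β x (T x)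

/-! ### Almost α-firm nonexpansiveness -/

/-- The transport discrepancy. -/
def psi (p c : ℝ) (T : G → G) (x y : G) : ℝ :=
  c / 2 * (dist (T x) x ^ p + dist (T y) y ^ p + dist (T x) (T y) ^ p + dist x y ^ p
    - dist (T x) y ^ p - dist x (T y) ^ p)

/-- The inequality of almost α-firm nonexpansiveness for a pair of points. -/
def FirmIneq (p c : ℝ) (T : G → G) (α ε : ℝ) (x y : G) : Prop :=
  dist (T x) (T y) ^ p ≤ (1 + ε) * dist x y ^ p - (1 - α) / α * psi p c T x y

/-- `T` is pointwise almost α-firmly nonexpansive at `y ∈ D` on `D` with constant `α` and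
violation `ε`. -/
def AlmostFirmAt (p c : ℝ) (T : G → G) (D : Set G) (y : G) (α ε : ℝ) : Prop :=
  0 < α ∧ α < 1 ∧ 0 ≤ ε ∧ y ∈ D ∧ ∀ x ∈ D, FirmIneq p c T α ε x y

/-- `T` is pointwise asymptotically α-firmly nonexpansive at `y` with constant `α`. -/
def AsympFirmAt (p c : ℝ) (T : G → G) (y : G) (α : ℝ) : Prop :=
  0 < α ∧ α < 1 ∧ ∀ ε > 0, ∃ D ∈ 𝓝 y, ∀ x ∈ D, FirmIneq p c T α ε x y

/-! ### The constants -/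

/-- `α_c` -/
def alphaC (c : ℝ) : ℝ := c * (c - 1) / (c * (c - 1) + 2)

/-- `ε_c` -/
def epsC (c : ℝ) : ℝ := (2 - c) / (c - 1)

/-- The constant of a composition of two mappings with constants `a` and `b`. -/
def alphaComp (c a b : ℝ) : ℝ :=
  (a + b - 2 * a * b) / (c / 2 * (1 - a - b + a * b) + a + b - 2 * a * b)

/-- `α_β` -/
def alphaKM (p c β : ℝ) : ℝ :=
  alphaC c * β ^ (p - 1) / (alphaC c * β ^ (p - 1) - alphaC c * β + 1)

/-- The asymptotic constant of the Krasnoselski-Mann relaxation of a proximal mapping. -/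
def alphaKMAsymp (p β : ℝ) : ℝ := β ^ (p - 1) / (β ^ (p - 1) - β + 2)

end ProxFirm

end

/-!
At a fixed point `y` of `T`, almost α-firm nonexpansiveness with respect to `r` reads
`d(Tx,y)^p + m d(Tx,x)^p ≤ (1 + ε) d(x,y)^p` with the weight `m = (r/2) (1-α)/α`: the step from `x`
to `Tx` is almost firm towards `y`. A value `Tx` of a proximal mapping or of a projector is nearest
to `x` along the geodesic from `Tx` to `y`. Uniform convexity, tested at points of this geodesic
that tend to `Tx`, gives `d(x,Tx)^p + (c/2) d(Tx,y)^p ≤ d(x,y)^p`, and in symmetric perpendicular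
spaces the roles of `x` and `y` may be exchanged. A composition of two steps with weights `m`, `n`
has the weight `(c/2) mn/(m+n)` by a weighted triangle inequality, and relaxed steps are estimated
by uniform convexity along the geodesic from `x` to `Tx`. Small triangles of a CAT(κ) space satisfy
the inequality of uniform convexity with `p = c = 2` up to a small relative error, so that the same
arguments with `c = 2` give the asymptotic constants.
-/

namespace ProxFirm

variable {G : Type*} [MetricSpace G] {p c : ℝ}

/-! ### Geodesics and uniform convexity -/

theorem IsGeodesic.dist_left {γ : ℝ → G} {x y : G} (h : IsGeodesic γ x y) {t : ℝ}
    (ht : t ∈ Icc (0 : ℝ) 1) : dist (γ t) x = t * dist x y := by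
  have := h.2.2 t ht 0 ⟨le_rfl, zero_le_one⟩
  rwa [h.1, sub_zero, abs_of_nonneg ht.1] at this

theorem IsGeodesic.dist_right {γ : ℝ → G} {x y : G} (h : IsGeodesic γ x y) {t : ℝ}
    (ht : t ∈ Icc (0 : ℝ) 1) : dist (γ t) y = (1 - t) * dist x y := by
  have := h.2.2 t ht 1 ⟨zero_le_one, le_rfl⟩
  rwa [h.2.1, abs_sub_comm, abs_of_nonneg (sub_nonneg.2 ht.2)] at this

theorem exists_isGeodesic_geoComb_eq (hG : IsGeodesicSpace G) (t : ℝ) (x y : G) :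
    ∃ γ : ℝ → G, IsGeodesic γ x y ∧ geoComb t x y = γ t := by
  have h := hG x y
  exact ⟨h.choose, h.choose_spec, by rw [geoComb, dif_pos h]⟩

theorem dist_km (hG : IsGeodesicSpace G) {β : ℝ} (hβ : β ∈ Icc (0 : ℝ) 1) (S : G → G) (x : G) :
    dist (km β S x) x = β * dist (S x) x := by
  obtain ⟨γ, hγ, hγβ⟩ := exists_isGeodesic_geoComb_eq hG β x (S x)
  rw [km, hγβ, hγ.dist_left hβ, dist_comm]

theorem km_eq_self (hG : IsGeodesicSpace G) {β : ℝ} (hβ : β ∈ Icc (0 : ℝ) 1) {S : G → G} {y : G}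
    (hy : S y = y) : km β S y = y := by
  have := dist_km hG hβ S y
  rwa [hy, dist_self, mul_zero, dist_eq_zero] at this

theorem IsPUniformlyConvex.exponent_pos (hG : IsPUniformlyConvex p c G) : 0 < p :=
  one_pos.trans hG.1

theorem IsPUniformlyConvex.isGeodesicSpace (hG : IsPUniformlyConvex p c G) : IsGeodesicSpace G :=
  hG.2.2.1

theorem IsPUniformlyConvex.rpow_dist_midpoint_le (hG : IsPUniformlyConvex p c G) {u v : G}
    {γ : ℝ → G} (hγ : IsGeodesic γ u v) (x : G) :
    dist x (γ (1 / 2)) ^ p ≤ (dist x u ^ p + dist x v ^ p) / 2 - c / 8 * dist u v ^ p := by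
  have := hG.2.2.2 u v x γ hγ (1 / 2) ⟨by norm_num, by norm_num⟩
  linarith

/-- Uniform convexity for triangles with vertices in `D`, up to an error of `δ` times the sum of
the `p`-th powers of the sides. It is exact for `δ = 0`; small triangles of a CAT(κ) space
satisfy it with `p = c = 2`. -/
def AlmostUniformlyConvexOn (p c δ : ℝ) (D : Set G) : Prop :=
  ∀ x ∈ D, ∀ y ∈ D, ∀ z ∈ D, ∀ γ : ℝ → G, IsGeodesic γ x y → ∀ t ∈ Icc (0 : ℝ) 1,
    dist z (γ t) ^ p ≤
      (1 - t) * dist z x ^ p + t * dist z y ^ p - c / 2 * (t * (1 - t)) * dist x y ^ p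
        + δ * (dist z x ^ p + dist z y ^ p + dist x y ^ p)

theorem AlmostUniformlyConvexOn.mono {δ δ' : ℝ} {D : Set G} (h : AlmostUniformlyConvexOn p c δ D)
    (hδ : δ ≤ δ') : AlmostUniformlyConvexOn p c δ' D :=
  fun x hx y hy z hz γ hγ t ht => (h x hx y hy z hz γ hγ t ht).trans (by gcongr)

/-- Near `y` the space is uniformly convex up to an arbitrarily small relative error. -/
def AsympUniformlyConvexAt (p c : ℝ) (y : G) : Prop :=
  ∀ δ > 0, ∃ D ∈ 𝓝 y, AlmostUniformlyConvexOn p c δ D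

theorem IsPUniformlyConvex.almostUniformlyConvexOn (hG : IsPUniformlyConvex p c G) :
    AlmostUniformlyConvexOn p c 0 (univ : Set G) := fun x _ y _ z _ γ hγ t ht => by
  simpa only [zero_mul, add_zero] using hG.2.2.2 x y z γ hγ t ht

/-- A triangle inequality for `p`-th powers of distances with the harmonic weight `mn / (m + n)`.
It holds with constant `c` in `p`-uniformly convex spaces, and with `p = c = 2` in all metric
spaces. -/
def WeightedTriangleIneq (p c : ℝ) (G : Type*) [MetricSpace G] : Prop :=
  ∀ m > 0, ∀ n > 0, ∀ x z w : G,
    c / 2 * (m * n / (m + n)) * dist x w ^ p ≤ m * dist x z ^ p + n * dist z w ^ p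

/-- Compare `z` with the point of `[x, w]` that divides it in the ratio `n : m`. -/
theorem IsPUniformlyConvex.weightedTriangleIneq (hG : IsPUniformlyConvex p c G) :
    WeightedTriangleIneq p c G := by
  intro m hm n hn x z w
  obtain ⟨γ, hγ⟩ := hG.isGeodesicSpace x w
  have hconv := hG.2.2.2 x w z γ hγ (n / (m + n))
    ⟨by positivity, (div_le_one (by positivity)).2 (by linarith)⟩
  have hnonneg := (Real.rpow_nonneg dist_nonneg p).trans hconv
  have hmul := mul_nonneg (add_pos hm hn).le hnonneg
  rw [one_sub_div (add_pos hm hn).ne', add_sub_cancel_right, dist_comm z x] at hmul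
  have hexpand : (m + n) * (m / (m + n) * dist x z ^ p + n / (m + n) * dist z w ^ p
      - c / 2 * (n / (m + n) * (m / (m + n))) * dist x w ^ p)
      = m * dist x z ^ p + n * dist z w ^ p - c / 2 * (m * n / (m + n)) * dist x w ^ p := by
    field_simp
  linarith

theorem weightedTriangleIneq_two : WeightedTriangleIneq 2 2 G := by
  intro m hm n hn x z w
  simp only [Real.rpow_two]
  calc 2 / 2 * (m * n / (m + n)) * dist x w ^ 2
      ≤ 2 / 2 * (m * n / (m + n)) * (dist x z + dist z w) ^ 2 := by
        gcongr; exact dist_triangle x z w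
    _ = m * dist x z ^ 2 + n * dist z w ^ 2 - (m * dist x z - n * dist z w) ^ 2 / (m + n) := by
        field_simp; ring
    _ ≤ m * dist x z ^ 2 + n * dist z w ^ 2 := sub_le_self _ (by positivity)

/-! ### Existence of proximal points and projections -/

theorem cauchySeq_of_mul_rpow_dist_le {k I : ℝ} (hp : 0 < p) (hk : 0 < k) {z : ℕ → G} {v : ℕ → ℝ}
    (hv : Antitone v) (hlim : Tendsto v atTop (𝓝 I))
    (hz : ∀ i j, k * dist (z i) (z j) ^ p ≤ (v i + v j) / 2 - I) : CauchySeq z := by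
  refine cauchySeq_of_le_tendsto_0 (fun N => ((v N - I) / k) ^ p⁻¹) (fun i j N hi hj => ?_) ?_
  · rw [Real.le_rpow_inv_iff_of_pos dist_nonneg
      (div_nonneg (sub_nonneg.2 (hv.le_of_tendsto hlim N)) hk.le) hp, le_div_iff₀' hk]
    linarith [hz i j, hv hi, hv hj]
  · have hgap : Tendsto (fun N => (v N - I) / k) atTop (𝓝 0) := by
      simpa using (hlim.sub_const I).div_const k
    simpa [Real.zero_rpow (inv_pos.2 hp).ne'] using
      hgap.rpow_const (Or.inr (inv_pos.2 hp).le)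

/-- Uniform midpoint convexity turns minimising sequences into Cauchy sequences. -/
theorem exists_forall_le_of_midpoint [CompleteSpace G] {k : ℝ} (hp : 0 < p) (hk : 0 < k)
    {A : Set G} {φ : G → ℝ} (hA : A.Nonempty) (hbdd : BddBelow (φ '' A))
    (hclosed : ∀ a, IsClosed {z | z ∈ A ∧ φ z ≤ a})
    (hmid : ∀ u ∈ A, ∀ v ∈ A, ∃ w ∈ A, φ w ≤ (φ u + φ v) / 2 - k * dist u v ^ p) :
    ∃ z ∈ A, ∀ w ∈ A, φ z ≤ φ w := by
  have hinf : ∀ w ∈ A, sInf (φ '' A) ≤ φ w := fun w hw => csInf_le hbdd ⟨w, hw, rfl⟩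
  obtain ⟨v, hanti, hlim, hv⟩ := exists_seq_tendsto_sInf (hA.image φ) hbdd
  choose z hzA hzv using hv
  have hcauchy : CauchySeq z := by
    refine cauchySeq_of_mul_rpow_dist_le hp hk hanti hlim fun i j => ?_
    obtain ⟨w, hwA, hw⟩ := hmid _ (hzA i) _ (hzA j)
    rw [hzv, hzv] at hw
    linarith [hinf w hwA]
  obtain ⟨x, hx⟩ := cauchySeq_tendsto_of_complete hcauchy
  have hsublevel : ∀ N, x ∈ A ∧ φ x ≤ v N := fun N =>
    (hclosed _).mem_of_tendsto hx
      (eventually_atTop.2 ⟨N, fun n hn => ⟨hzA n, (hzv n).trans_le (hanti hn)⟩⟩)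
  exact ⟨x, (hsublevel 0).1, fun w hw =>
    (ge_of_tendsto' hlim fun N => (hsublevel N).2).trans (hinf w hw)⟩

theorem proj_spec [CompleteSpace G] (hG : IsPUniformlyConvex p c G) {C : Set G}
    (hC : IsClosed C) (hconv : IsGeodConvex C) (hne : C.Nonempty) (x : G) :
    proj C x ∈ C ∧ ∀ w ∈ C, dist x (proj C x) ≤ dist x w := by
  have hp := hG.exponent_pos
  have hclosed : ∀ a, IsClosed {z | z ∈ C ∧ dist x z ^ p ≤ a} := fun a =>
    hC.inter (isClosed_le ((continuous_const.dist continuous_id).rpow_const fun _ => Or.inr hp.le)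
      continuous_const)
  have hmid : ∀ u ∈ C, ∀ v ∈ C, ∃ w ∈ C,
      dist x w ^ p ≤ (dist x u ^ p + dist x v ^ p) / 2 - c / 8 * dist u v ^ p := by
    intro u hu v hv
    obtain ⟨γ, hγ⟩ := hG.isGeodesicSpace u v
    exact ⟨γ (1 / 2), hconv u hu v hv γ hγ _ ⟨by norm_num, by norm_num⟩,
      hG.rpow_dist_midpoint_le hγ x⟩
  obtain ⟨z, hz, hmin⟩ := exists_forall_le_of_midpoint hp (by linarith [hG.2.1] : 0 < c / 8) hne
    ⟨0, by rintro _ ⟨z, -, rfl⟩; positivity⟩ hclosed hmid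
  have h : ∃ z ∈ C, ∀ w ∈ C, dist x z ≤ dist x w :=
    ⟨z, hz, fun w hw => (Real.rpow_le_rpow_iff dist_nonneg dist_nonneg hp).1 (hmin w hw)⟩
  rw [proj, dif_pos h]
  exact h.choose_spec

section Prox

variable {f : G → EReal} (hf : IsProperConvexLsc f)
include hf

theorem IsProperConvexLsc.ne_top_of_mem_argmin {y : G} (hy : y ∈ argmin f) : f y ≠ ⊤ := by
  obtain ⟨w, hw⟩ := hf.2.1
  exact ne_top_of_le_ne_top hw (hy w)

theorem IsProperConvexLsc.coe_toReal {z : G} (hz : f z ≠ ⊤) : ((f z).toReal : EReal) = f z :=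
  EReal.coe_toReal hz (hf.1 z)

theorem IsProperConvexLsc.toReal_le_of_mem_argmin {y z : G} (hy : y ∈ argmin f) (hz : f z ≠ ⊤) :
    (f y).toReal ≤ (f z).toReal :=
  EReal.toReal_le_toReal (hy z) (hf.1 y) hz

theorem IsProperConvexLsc.ne_top_and_toReal_le {u v : G} (hu : f u ≠ ⊤) (hv : f v ≠ ⊤)
    {γ : ℝ → G} (hγ : IsGeodesic γ u v) {t : ℝ} (ht : t ∈ Icc (0 : ℝ) 1) :
    f (γ t) ≠ ⊤ ∧ (f (γ t)).toReal ≤ (1 - t) * (f u).toReal + t * (f v).toReal := by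
  have h := hf.2.2.2 u v γ hγ t ht
  rw [← hf.coe_toReal hu, ← hf.coe_toReal hv, ← EReal.coe_mul, ← EReal.coe_mul,
    ← EReal.coe_add] at h
  have hne : f (γ t) ≠ ⊤ := ne_top_of_le_ne_top (EReal.coe_ne_top _) h
  exact ⟨hne, by rwa [← hf.coe_toReal hne, EReal.coe_le_coe_iff] at h⟩

theorem IsProperConvexLsc.proxObj_eq_coe (p l : ℝ) (x : G) {z : G} (hz : f z ≠ ⊤) :
    proxObj p l f x z
      = (((f z).toReal + 1 / (p * l ^ (p - 1)) * dist z x ^ p : ℝ) : EReal) := by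
  rw [proxObj, EReal.coe_add, hf.coe_toReal hz]

theorem IsProperConvexLsc.proxObj_le_coe_iff (p l : ℝ) (x z : G) (a : ℝ) :
    proxObj p l f x z ≤ a ↔
      f z ≠ ⊤ ∧ (f z).toReal + 1 / (p * l ^ (p - 1)) * dist z x ^ p ≤ a := by
  by_cases hz : f z = ⊤
  · rw [proxObj, hz, EReal.top_add_coe]
    simp only [top_le_iff, EReal.coe_ne_top, ne_eq, not_true_eq_false, false_and]
  · rw [hf.proxObj_eq_coe p l x hz, EReal.coe_le_coe_iff, and_iff_right hz]

theorem IsProperConvexLsc.lowerSemicontinuous_proxObj (hp : 0 ≤ p) (l : ℝ) (x : G) :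
    LowerSemicontinuous (proxObj p l f x) := by
  refine hf.2.2.1.add' (Continuous.lowerSemicontinuous ?_) fun z => ?_
  · exact continuous_coe_real_ereal.comp (by fun_prop (disch := positivity))
  · exact EReal.continuousAt_add (Or.inr (EReal.coe_ne_bot _)) (Or.inr (EReal.coe_ne_top _))

theorem IsProperConvexLsc.exists_mem_argmin_proxObj [CompleteSpace G]
    (hG : IsPUniformlyConvex p c G) {l : ℝ} (hl : 0 < l) (hne : (argmin f).Nonempty) (x : G) :
    ∃ z, z ∈ argmin (proxObj p l f x) := by
  have hp := hG.exponent_pos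
  have hc := hG.2.1
  obtain ⟨y, hy⟩ := hne
  set μ := 1 / (p * l ^ (p - 1))
  have hμ0 : 0 < μ := by positivity
  let φ : G → ℝ := fun z => (f z).toReal + μ * dist z x ^ p
  have hbdd : BddBelow (φ '' {z | f z ≠ ⊤}) := by
    refine ⟨(f y).toReal, ?_⟩
    rintro _ ⟨z, hz, rfl⟩
    exact le_add_of_le_of_nonneg (hf.toReal_le_of_mem_argmin hy hz) (by positivity)
  have hclosed : ∀ a, IsClosed {z | f z ≠ ⊤ ∧ φ z ≤ a} := fun a => by
    simpa only [preimage, mem_Iic, hf.proxObj_le_coe_iff] using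
      (hf.lowerSemicontinuous_proxObj hp.le l x).isClosed_preimage (a : EReal)
  have hmid : ∀ u, f u ≠ ⊤ → ∀ v, f v ≠ ⊤ → ∃ w, f w ≠ ⊤ ∧
      φ w ≤ (φ u + φ v) / 2 - μ * (c / 8) * dist u v ^ p := by
    intro u hu v hv
    obtain ⟨γ, hγ⟩ := hG.isGeodesicSpace u v
    obtain ⟨hw, hfw⟩ := hf.ne_top_and_toReal_le hu hv hγ (t := 1 / 2)
      ⟨by norm_num, by norm_num⟩
    have hdist := mul_le_mul_of_nonneg_left (hG.rpow_dist_midpoint_le hγ x) hμ0.le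
    refine ⟨γ (1 / 2), hw, ?_⟩
    simp only [φ, dist_comm _ x]
    linarith
  obtain ⟨z, hz, hmin⟩ := exists_forall_le_of_midpoint hp (by positivity : 0 < μ * (c / 8))
    ⟨y, hf.ne_top_of_mem_argmin hy⟩ hbdd hclosed hmid
  refine ⟨z, fun w => ?_⟩
  by_cases hw : f w = ⊤
  · rw [proxObj.eq_def p l f x w, hw, EReal.top_add_coe]
    exact le_top
  · rw [hf.proxObj_eq_coe p l x hw, hf.proxObj_le_coe_iff]
    exact ⟨hz, hmin w hw⟩

theorem IsProperConvexLsc.prox_mem_argmin [CompleteSpace G] (hG : IsPUniformlyConvex p c G)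
    {l : ℝ} (hl : 0 < l) (hne : (argmin f).Nonempty) (x : G) :
    prox p l f x ∈ argmin (proxObj p l f x) := by
  have h := hf.exists_mem_argmin_proxObj hG hl hne x
  rw [prox, dif_pos h]
  exact h.choose_spec

end Prox

/-! ### Nearest points along geodesics -/

/-- On every geodesic from `u` to `y`, the endpoint `u` is nearest to `x`. -/
def IsNearestAlong (x u y : G) : Prop :=
  ∀ γ : ℝ → G, IsGeodesic γ u y → ∀ t ∈ Icc (0 : ℝ) 1, dist x u ≤ dist x (γ t)

theorem IsNearestAlong.dist_le (hG : IsGeodesicSpace G) {x u y : G} (h : IsNearestAlong x u y) :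
    dist x u ≤ dist x y := by
  obtain ⟨γ, hγ⟩ := hG u y
  simpa only [hγ.2.1] using h γ hγ 1 ⟨zero_le_one, le_rfl⟩

theorem IsNearestAlong.dist_le_two_mul (hG : IsGeodesicSpace G) {x u y : G}
    (h : IsNearestAlong x u y) : dist u y ≤ 2 * dist x y := by
  linarith [dist_triangle_left u y x, h.dist_le hG]

theorem IsNearestAlong.eq_of_self (hG : IsGeodesicSpace G) {u y : G}
    (h : IsNearestAlong y u y) : u = y := by
  have := h.dist_le hG
  rwa [dist_self, dist_le_zero, eq_comm] at this

theorem IsNearestAlong.symm (hG : IsGeodesicSpace G) (hS : IsSymmPerp G) {x u y : G}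
    (h : IsNearestAlong x u y) : IsNearestAlong y u x := by
  intro γ hγ t ht
  obtain ⟨η, hη⟩ := hG u y
  have h0 : (0 : ℝ) ∈ Icc (0 : ℝ) 1 := ⟨le_rfl, zero_le_one⟩
  have h1 : (1 : ℝ) ∈ Icc (0 : ℝ) 1 := ⟨zero_le_one, le_rfl⟩
  have hperp : Perp (γ '' Icc (0 : ℝ) 1) (η '' Icc (0 : ℝ) 1) u := by
    rintro _ ⟨s, hs, rfl⟩ _ ⟨r, hr, rfl⟩
    have hnear := h η hη r hr
    have htri := dist_triangle_left x (η r) (γ s)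
    rw [hγ.dist_right hs] at htri
    rw [hγ.dist_left hs]
    rw [dist_comm x u] at hnear
    linarith
  have hperp' := (hS _ _ ⟨u, x, γ, hγ, rfl⟩ ⟨u, y, η, hη, rfl⟩ u
    ⟨⟨0, h0, hγ.1⟩, ⟨0, h0, hη.1⟩⟩).1 hperp
  exact hperp' y ⟨1, h1, hη.2.1⟩ _ ⟨t, ht, rfl⟩

/-- Test almost uniform convexity at the point `γ t` of a geodesic from `u` to `y`, which is not
closer to `x` than `u` is. -/
theorem AlmostUniformlyConvexOn.rpow_dist_add_le {δ : ℝ} {D : Set G}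
    (hD : AlmostUniformlyConvexOn p c δ D) (hp : 0 ≤ p) (hG : IsGeodesicSpace G) {x u y : G}
    (hx : x ∈ D) (hu : u ∈ D) (hy : y ∈ D) (h : IsNearestAlong x u y) {t : ℝ}
    (ht : t ∈ Ioc (0 : ℝ) 1) :
    dist x u ^ p + c / 2 * (1 - t) * dist u y ^ p ≤
      dist x y ^ p + δ / t * (dist x u ^ p + dist x y ^ p + dist u y ^ p) := by
  obtain ⟨γ, hγ⟩ := hG u y
  have ht' := Ioc_subset_Icc_self ht
  have hnear := Real.rpow_le_rpow dist_nonneg (h γ hγ t ht') hp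
  have hconv := hD u hu y hy x hx γ hγ t ht'
  refine le_of_mul_le_mul_left ?_ ht.1
  have hδ : t * (δ / t) = δ := mul_div_cancel₀ δ ht.1.ne'
  rw [mul_add t (dist x y ^ p), ← mul_assoc t (δ / t), hδ]
  linarith

theorem IsNearestAlong.rpow_dist_add_le (hG : IsPUniformlyConvex p c G) {x u y : G}
    (h : IsNearestAlong x u y) : dist x u ^ p + c / 2 * dist u y ^ p ≤ dist x y ^ p := by
  have hlim : Tendsto (fun t : ℝ => dist x u ^ p + c / 2 * (1 - t) * dist u y ^ p) (𝓝[>] 0)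
      (𝓝 (dist x u ^ p + c / 2 * dist u y ^ p)) := by
    have : Continuous fun t : ℝ => dist x u ^ p + c / 2 * (1 - t) * dist u y ^ p := by fun_prop
    simpa using (this.tendsto 0).mono_left nhdsWithin_le_nhds
  refine le_of_tendsto hlim ?_
  filter_upwards [Ioc_mem_nhdsGT one_pos] with t ht
  simpa only [zero_div, zero_mul, add_zero] using
    hG.almostUniformlyConvexOn.rpow_dist_add_le hG.exponent_pos.le hG.isGeodesicSpace
      (mem_univ x) (mem_univ u) (mem_univ y) h ht

/-- The value `T x` is nearest to `x` along the geodesics from `T x` to `y`, for all `x`. This is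
all that is used about proximal mappings (with `y` a minimiser) and projectors (with `y` in the
set). -/
def IsNearestMapAt (T : G → G) (y : G) : Prop :=
  ∀ x, IsNearestAlong x (T x) y

theorem isNearestMapAt_proj [CompleteSpace G] (hG : IsPUniformlyConvex p c G)
    {C : Set G} (hC : IsClosed C) (hconv : IsGeodConvex C) {y : G} (hy : y ∈ C) :
    IsNearestMapAt (proj C) y := by
  intro x
  obtain ⟨hmem, hmin⟩ := proj_spec hG hC hconv ⟨y, hy⟩ x
  exact fun γ hγ t ht => hmin _ (hconv _ hmem y hy γ hγ t ht)

theorem isNearestMapAt_prox [CompleteSpace G] (hG : IsPUniformlyConvex p c G) {l : ℝ}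
    (hl : 0 < l) {f : G → EReal} (hf : IsProperConvexLsc f) {y : G} (hy : y ∈ argmin f) :
    IsNearestMapAt (prox p l f) y := by
  intro x
  have hp := hG.exponent_pos
  have hprox := hf.prox_mem_argmin hG hl ⟨y, hy⟩ x
  have hy_top := hf.ne_top_of_mem_argmin hy
  set u := prox p l f x
  have hu_top : f u ≠ ⊤ := by
    have h := hprox y
    rw [hf.proxObj_eq_coe p l x hy_top, hf.proxObj_le_coe_iff] at h
    exact h.1
  intro γ hγ t ht
  obtain ⟨hγ_top, hfγ⟩ := hf.ne_top_and_toReal_le hu_top hy_top hγ ht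
  have hfγ_le : (f (γ t)).toReal ≤ (f u).toReal := by
    linarith [mul_le_mul_of_nonneg_left (hf.toReal_le_of_mem_argmin hy hu_top) ht.1]
  have hobj := hprox (γ t)
  rw [hf.proxObj_eq_coe p l x hγ_top, hf.proxObj_le_coe_iff] at hobj
  have hdist := le_of_mul_le_mul_left
    (by linarith [hobj.2] : 1 / (p * l ^ (p - 1)) * dist u x ^ p
      ≤ 1 / (p * l ^ (p - 1)) * dist (γ t) x ^ p) (by positivity)
  rw [dist_comm x, dist_comm x]
  exact (Real.rpow_le_rpow_iff dist_nonneg dist_nonneg hp).1 hdist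

theorem IsNearestMapAt.map_eq (hG : IsGeodesicSpace G) {T : G → G} {y : G}
    (hT : IsNearestMapAt T y) : T y = y :=
  (hT y).eq_of_self hG

theorem IsNearestMapAt.tendsto (hG : IsGeodesicSpace G) {T : G → G} {y : G}
    (hT : IsNearestMapAt T y) : Tendsto T (𝓝 y) (𝓝 y) := by
  refine tendsto_iff_dist_tendsto_zero.2
    (squeeze_zero (fun _ => dist_nonneg) (fun x => (hT x).dist_le_two_mul hG) ?_)
  have : Continuous fun x => 2 * dist x y := by fun_prop
  simpa only [dist_self, mul_zero] using this.tendsto y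

end ProxFirm

namespace ProxFirm

variable {G : Type*} [MetricSpace G]

/-! ### Small triangles in CAT(κ) spaces -/

theorem one_sub_mul_le_sin {x δ : ℝ} (hx : 0 ≤ x) (hxδ : x ^ 2 ≤ δ) :
    (1 - δ) * x ≤ Real.sin x := by
  rcases hx.eq_or_lt with rfl | hpos
  · simp
  · nlinarith [Real.sin_gt_sub_cube hpos, mul_le_mul_of_nonneg_left hxδ hx, pow_pos hpos 3]

theorem sin_add_sin_sub_sin_add (a b : ℝ) :
    Real.sin a + Real.sin b - Real.sin (a + b)
      = 4 * (Real.sin (a / 2) * Real.sin (b / 2) * Real.sin ((a + b) / 2)) := by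
  obtain ⟨u, rfl⟩ : ∃ u, a = 2 * u := ⟨a / 2, by ring⟩
  obtain ⟨v, rfl⟩ : ∃ v, b = 2 * v := ⟨b / 2, by ring⟩
  rw [← mul_add, mul_div_cancel_left₀ u two_ne_zero, mul_div_cancel_left₀ v two_ne_zero,
    mul_div_cancel_left₀ (u + v) two_ne_zero, Real.sin_two_mul, Real.sin_two_mul,
    Real.sin_two_mul, Real.sin_add, Real.cos_add]
  linear_combination -2 * Real.sin u * Real.cos u * Real.sin_sq_add_cos_sq v
    - 2 * Real.sin v * Real.cos v * Real.sin_sq_add_cos_sq u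

theorem one_sub_sq_mul_le_one_sub_cos {x δ : ℝ} (hδ : δ ≤ 1) (hx : 0 ≤ x) (hxδ : x ^ 2 ≤ δ) :
    (1 - δ) ^ 2 * (x ^ 2 / 2) ≤ 1 - Real.cos x := by
  have hsin : (1 - δ) * (x / 2) ≤ Real.sin (x / 2) :=
    one_sub_mul_le_sin (by positivity) (by linarith [sq_nonneg x])
  have hhalf : 1 - Real.cos x = 2 * Real.sin (x / 2) ^ 2 := by
    rw [Real.sin_sq_eq_half_sub, mul_div_cancel₀ x two_ne_zero]
    ring
  have hsq := pow_le_pow_left₀ (mul_nonneg (sub_nonneg.2 hδ) (by positivity)) hsin 2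
  linarith

/-- `a`, `b`, `θ` are the sides of a spherical triangle, and `m` is the length of the segment to
the point that divides the side `θ` in the ratio `s : 1 - s`. -/
theorem sq_add_le_of_cos_mul_sin_eq {θ a b m s δ : ℝ} (hδ : δ ≤ 1) (hθ : 0 < θ) (hθδ : θ ^ 2 ≤ δ)
    (hm : 0 ≤ m) (hmδ : m ^ 2 ≤ δ) (hs : s ∈ Icc (0 : ℝ) 1)
    (h : Real.cos m * Real.sin θ
      = Real.sin ((1 - s) * θ) * Real.cos b + Real.sin (s * θ) * Real.cos a) :
    (1 - δ) ^ 3 * (m ^ 2 + s * (1 - s) * θ ^ 2) ≤ (1 - s) * b ^ 2 + s * a ^ 2 := by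
  have : 0 ≤ 1 - δ := sub_nonneg.2 hδ
  have hs' : 0 ≤ 1 - s := sub_nonneg.2 hs.2
  have hsθ : 0 ≤ s * θ := mul_nonneg hs.1 hθ.le
  have htθ : 0 ≤ (1 - s) * θ := mul_nonneg hs' hθ.le
  have hsin : ∀ x, 0 ≤ x → x ≤ θ → (1 - δ) * x ≤ Real.sin x := fun x hx hxθ =>
    one_sub_mul_le_sin hx ((pow_le_pow_left₀ hx hxθ 2).trans hθδ)
  have hcos : ∀ x : ℝ, 1 - Real.cos x ≤ x ^ 2 / 2 := fun x => by
    linarith [Real.one_sub_sq_div_two_le_cos (x := x)]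
  have hside : ∀ x y : ℝ, 0 ≤ x → Real.sin x * (1 - Real.cos y) ≤ x * (y ^ 2 / 2) :=
    fun x y hx => mul_le_mul (Real.sin_le hx) (hcos y) (by linarith [Real.cos_le_one y]) hx
  have hprod := sin_add_sin_sub_sin_add (s * θ) ((1 - s) * θ)
  rw [show s * θ + (1 - s) * θ = θ by ring] at hprod
  have hprod_ge : (1 - δ) * (s * θ / 2) * ((1 - δ) * ((1 - s) * θ / 2)) * ((1 - δ) * (θ / 2))
      ≤ Real.sin (s * θ / 2) * Real.sin ((1 - s) * θ / 2) * Real.sin (θ / 2) := by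
    have hsin_s := hsin (s * θ / 2) (by positivity) (by nlinarith [hs.2])
    have hsin_t := hsin ((1 - s) * θ / 2) (by positivity) (by nlinarith [hs.1])
    have hsin_θ := hsin (θ / 2) (by positivity) (by linarith)
    have hs_nonneg := (by positivity : 0 ≤ (1 - δ) * (s * θ / 2)).trans hsin_s
    have ht_nonneg := (by positivity : 0 ≤ (1 - δ) * ((1 - s) * θ / 2)).trans hsin_t
    gcongr
  have hleft : (1 - δ) ^ 2 * (m ^ 2 / 2) * ((1 - δ) * θ) ≤ (1 - Real.cos m) * Real.sin θ :=
    mul_le_mul (one_sub_sq_mul_le_one_sub_cos hδ hm hmδ) (hsin θ hθ.le le_rfl) (by positivity)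
      (by linarith [Real.cos_le_one m])
  refine le_of_mul_le_mul_left ?_ (by positivity : 0 < θ / 2)
  linarith [hside _ b htθ, hside _ a hsθ]

section Slerp

open InnerProductGeometry

variable {V : Type*} [NormedAddCommGroup V] [InnerProductSpace ℝ V]

/-- Spherical linear interpolation: for unit vectors at an angle in `(0, π)`, the point that divides
the great-circle arc from `u` to `y` in the ratio `s : 1 - s`. -/
noncomputable def slerp (u y : V) (s : ℝ) : V :=
  (Real.sin ((1 - s) * angle u y) / Real.sin (angle u y)) • u
    + (Real.sin (s * angle u y) / Real.sin (angle u y)) • y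

theorem slerp_symm (u y : V) (s : ℝ) : slerp y u (1 - s) = slerp u y s := by
  rw [slerp, slerp, angle_comm y u, sub_sub_cancel, add_comm]

variable {u y : V} {s : ℝ}

theorem inner_slerp_mul_sin (hsin : Real.sin (angle u y) ≠ 0) (x : V) :
    inner ℝ (slerp u y s) x * Real.sin (angle u y)
      = Real.sin ((1 - s) * angle u y) * inner ℝ u x
        + Real.sin (s * angle u y) * inner ℝ y x := by
  rw [slerp, inner_add_left, real_inner_smul_left, real_inner_smul_left]
  field_simp

variable (hu : ‖u‖ = 1) (hy : ‖y‖ = 1) (hsin : Real.sin (angle u y) ≠ 0)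
include hu hy hsin

theorem inner_slerp_left : inner ℝ (slerp u y s) u = Real.cos (s * angle u y) := by
  have hsub : Real.sin ((1 - s) * angle u y)
      = Real.sin (angle u y) * Real.cos (s * angle u y)
        - Real.cos (angle u y) * Real.sin (s * angle u y) := by
    rw [← Real.sin_sub, one_sub_mul]
  refine mul_right_cancel₀ hsin ?_
  rw [inner_slerp_mul_sin hsin, real_inner_self_eq_norm_sq, hu, real_inner_comm,
    inner_eq_cos_angle_of_norm_eq_one hu hy, hsub]
  ring

theorem inner_slerp_right : inner ℝ (slerp u y s) y = Real.cos ((1 - s) * angle u y) := by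
  rw [← slerp_symm, inner_slerp_left hy hu (by rwa [angle_comm]), angle_comm]

theorem norm_slerp : ‖slerp u y s‖ = 1 := by
  have hadd : Real.sin (angle u y)
      = Real.sin ((1 - s) * angle u y) * Real.cos (s * angle u y)
        + Real.cos ((1 - s) * angle u y) * Real.sin (s * angle u y) := by
    rw [← Real.sin_add]
    ring_nf
  have hsq : ‖slerp u y s‖ ^ 2 = 1 := by
    refine mul_right_cancel₀ hsin ?_
    rw [← real_inner_self_eq_norm_sq, inner_slerp_mul_sin hsin, real_inner_comm,
      inner_slerp_left hu hy hsin, real_inner_comm, inner_slerp_right hu hy hsin]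
    linarith
  exact (pow_eq_one_iff_of_nonneg (norm_nonneg _) two_ne_zero).1 hsq

theorem angle_slerp_left (hs : s ∈ Icc (0 : ℝ) 1) :
    angle u (slerp u y s) = s * angle u y := by
  rw [angle, real_inner_comm, inner_slerp_left hu hy hsin, hu, norm_slerp hu hy hsin, mul_one,
    div_one]
  exact Real.arccos_cos (mul_nonneg hs.1 (angle_nonneg u y))
    ((mul_le_of_le_one_left (angle_nonneg u y) hs.2).trans (angle_le_pi u y))

theorem angle_slerp_right (hs : s ∈ Icc (0 : ℝ) 1) :
    angle (slerp u y s) y = (1 - s) * angle u y := by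
  rw [angle_comm, ← slerp_symm, angle_slerp_left hy hu (by rwa [angle_comm])
    (Icc.one_sub_mem hs), angle_comm]

theorem cos_angle_slerp_mul_sin {x : V} (hx : ‖x‖ = 1) :
    Real.cos (angle (slerp u y s) x) * Real.sin (angle u y)
      = Real.sin ((1 - s) * angle u y) * Real.cos (angle u x)
        + Real.sin (s * angle u y) * Real.cos (angle y x) := by
  rw [← inner_eq_cos_angle_of_norm_eq_one (norm_slerp hu hy hsin) hx,
    ← inner_eq_cos_angle_of_norm_eq_one hu hx, ← inner_eq_cos_angle_of_norm_eq_one hy hx,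
    inner_slerp_mul_sin hsin]

theorem sq_angle_slerp_le {x : V} (hx : ‖x‖ = 1) {δ r : ℝ} (hδ : δ ≤ 1) (hr : (2 * r) ^ 2 ≤ δ)
    (huy : angle u y ≤ r) (hux : angle u x ≤ r) (hs : s ∈ Icc (0 : ℝ) 1) :
    angle (slerp u y s) x ^ 2 ≤
      (1 - s) * angle u x ^ 2 + s * angle y x ^ 2 - s * (1 - s) * angle u y ^ 2
        + 9 * δ * (angle u x ^ 2 + angle y x ^ 2 + angle u y ^ 2) := by
  have hθ : 0 < angle u y := (angle_nonneg u y).lt_of_ne fun h => hsin (by rw [← h, Real.sin_zero])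
  have hm_tri : angle (slerp u y s) x ≤ angle u y + angle u x := by
    have htri := angle_le_angle_add_angle (slerp u y s) u x
    rw [angle_comm (slerp u y s) u, angle_slerp_left hu hy hsin hs] at htri
    exact htri.trans (by gcongr; exact mul_le_of_le_one_left hθ.le hs.2)
  have htrig := cos_angle_slerp_mul_sin (s := s) hu hy hsin hx
  have hm := angle_nonneg (slerp u y s) x
  have hb := angle_nonneg u x
  generalize angle (slerp u y s) x = m at *
  generalize angle u y = θ at *
  generalize angle u x = b at *
  generalize angle y x = a at *
  have hδ0 : 0 ≤ δ := (sq_nonneg _).trans hr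
  have hmδ : m ^ 2 ≤ δ := (pow_le_pow_left₀ hm (by linarith) 2).trans hr
  have hθδ : θ ^ 2 ≤ δ := (pow_le_pow_left₀ hθ.le (by linarith) 2).trans hr
  have hmain := sq_add_le_of_cos_mul_sin_eq hδ hθ hθδ hm hmδ hs htrig
  have hbernoulli : 1 - 3 * δ ≤ (1 - δ) ^ 3 := by nlinarith [mul_nonneg hδ0 (sub_nonneg.2 hδ)]
  have hlhs : 0 ≤ m ^ 2 + s * (1 - s) * θ ^ 2 := by
    have := sub_nonneg.2 hs.2
    have := hs.1
    positivity
  have hlhs_le : m ^ 2 + s * (1 - s) * θ ^ 2 ≤ 3 * (b ^ 2 + a ^ 2 + θ ^ 2) := by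
    have hm_sq := pow_le_pow_left₀ hm hm_tri 2
    nlinarith [sq_nonneg (θ - b), sq_nonneg (s - 1 / 2), sq_nonneg a, sq_nonneg b, sq_nonneg θ]
  nlinarith [mul_le_mul_of_nonneg_right hbernoulli hlhs, mul_le_mul_of_nonneg_left hlhs_le hδ0]

end Slerp

theorem Sph.norm_eq_one (u : Sph) : ‖(u : EuclideanSpace ℝ (Fin 3))‖ = 1 :=
  mem_sphere_zero_iff_norm.1 u.2

theorem modelDist_self (κ : ℝ) (u : Sph) : modelDist κ u u = 0 := by
  have hu : (u : EuclideanSpace ℝ (Fin 3)) ≠ 0 := ne_zero_of_mem_unit_sphere u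
  rw [modelDist, InnerProductGeometry.angle_self hu, zero_div]

theorem angle_eq_sqrt_mul_modelDist {κ : ℝ} (hκ : 0 < κ) (u v : Sph) :
    InnerProductGeometry.angle (u : EuclideanSpace ℝ (Fin 3)) v = √κ * modelDist κ u v :=
  (mul_div_cancel₀ _ (Real.sqrt_pos.2 hκ).ne').symm

theorem exists_modelDist_eq_mul_and_sq_le {κ δ r : ℝ} (hκ : 0 < κ) (hδ : δ ≤ 1)
    (hr : κ * (2 * r) ^ 2 ≤ δ) {u y x : Sph} (hpos : 0 < modelDist κ u y)
    (huy : modelDist κ u y ≤ r) (hux : modelDist κ u x ≤ r) {s : ℝ} (hs : s ∈ Icc (0 : ℝ) 1) :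
    ∃ w : Sph, modelDist κ u w = s * modelDist κ u y ∧ modelDist κ w y = (1 - s) * modelDist κ u y ∧
      modelDist κ w x ^ 2 ≤
        (1 - s) * modelDist κ u x ^ 2 + s * modelDist κ y x ^ 2
          - s * (1 - s) * modelDist κ u y ^ 2
          + 9 * δ * (modelDist κ u x ^ 2 + modelDist κ y x ^ 2 + modelDist κ u y ^ 2) := by
  have hq := Real.sqrt_pos.2 hκ
  have hr' : (2 * (√κ * r)) ^ 2 ≤ δ := by
    rwa [mul_left_comm, mul_pow, Real.sq_sqrt hκ.le]
  have hsin : Real.sin (InnerProductGeometry.angle (u : EuclideanSpace ℝ (Fin 3)) y) ≠ 0 := by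
    rw [angle_eq_sqrt_mul_modelDist hκ]
    refine (Real.sin_pos_of_pos_of_lt_pi (mul_pos hq hpos) ?_).ne'
    have := mul_le_mul_of_nonneg_left huy hq.le
    nlinarith [Real.pi_gt_three]
  have hunit := Sph.norm_eq_one
  let w : Sph := ⟨slerp u y s, mem_sphere_zero_iff_norm.2 (norm_slerp (hunit u) (hunit y) hsin)⟩
  refine ⟨w, ?_, ?_, ?_⟩
  · rw [modelDist, angle_slerp_left (hunit u) (hunit y) hsin hs, mul_div_assoc, modelDist]
  · rw [modelDist, angle_slerp_right (hunit u) (hunit y) hsin hs, mul_div_assoc, modelDist]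
  · have hsq := sq_angle_slerp_le (hunit u) (hunit y) hsin (hunit x) hδ hr'
      (by rw [angle_eq_sqrt_mul_modelDist hκ]; gcongr)
      (by rw [angle_eq_sqrt_mul_modelDist hκ]; gcongr) hs
    change InnerProductGeometry.angle (w : EuclideanSpace ℝ (Fin 3)) x ^ 2 ≤ _ at hsq
    simp only [angle_eq_sqrt_mul_modelDist hκ, mul_pow, Real.sq_sqrt hκ.le] at hsq
    refine le_of_mul_le_mul_left ?_ hκ
    linarith

theorem IsCAT.almostUniformlyConvexOn_ball {κ δ r : ℝ} (hG : IsCAT κ G) (hδ : δ ≤ 1)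
    (hr : κ * (4 * r) ^ 2 ≤ δ) (y : G) :
    AlmostUniformlyConvexOn 2 2 (9 * δ) (Metric.ball y r) := by
  obtain ⟨hκ, hgeo, hcomp⟩ := hG
  intro u hu v hv x hx γ hγ s hs
  have hdist : ∀ {a b : G}, a ∈ Metric.ball y r → b ∈ Metric.ball y r → dist a b ≤ 2 * r :=
    fun {a b} ha hb => by
      linarith [dist_triangle_right a b y, Metric.mem_ball.1 ha, Metric.mem_ball.1 hb]
  have hr0 : 0 < r := dist_nonneg.trans_lt hu
  have hr_small : 4 * r * √κ ≤ 1 := by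
    rw [← sq_le_one_iff₀ (by positivity), mul_pow, Real.sq_sqrt hκ.le, mul_comm]
    exact hr.trans hδ
  have hr_pi : 4 * r < Real.pi / √κ := by
    rw [lt_div_iff₀ (Real.sqrt_pos.2 hκ)]
    linarith [Real.pi_gt_three]
  simp only [Real.rpow_two]
  rcases eq_or_ne u v with rfl | hne
  · have hγs : γ s = u := by simpa only [dist_self, mul_zero, dist_eq_zero] using hγ.dist_left hs
    have hδ0 : 0 ≤ δ := (by positivity : 0 ≤ κ * (4 * r) ^ 2).trans hr
    rw [hγs, dist_self]
    linarith [(by positivity : 0 ≤ 9 * δ * (dist x u ^ 2 + dist x u ^ 2 + 0 ^ 2))]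
  obtain ⟨η, hη⟩ := hgeo u x (by linarith [hdist hu hx])
  obtain ⟨u', v', x', huv, hvx, hux, hle⟩ := hcomp u v x γ η hγ hη (by
    rw [mul_div_assoc]
    linarith [hdist hu hv, hdist hv hx, hdist hx hu])
  obtain ⟨w, hwu, hwv, hwx⟩ := exists_modelDist_eq_mul_and_sq_le (r := 2 * r) (x := x') hκ hδ
    (by linarith) (huv ▸ dist_pos.2 hne) (huv ▸ hdist hu hv) (hux ▸ hdist hu hx) hs
  rw [huv] at hwu hwv
  have hcompare : dist (γ s) x ≤ modelDist κ w x' := by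
    simpa only [hη.2.1] using hle s hs 1 ⟨zero_le_one, le_rfl⟩ w x' hwu hwv
      (by rw [hux, one_mul]) (by rw [modelDist_self, sub_self, zero_mul])
  rw [huv, hvx, hux] at hwx
  rw [dist_comm x (γ s), dist_comm x u, dist_comm x v]
  linarith [pow_le_pow_left₀ dist_nonneg hcompare 2]

theorem IsCAT.asympUniformlyConvexAt {κ : ℝ} (hG : IsCAT κ G) (y : G) :
    AsympUniformlyConvexAt 2 2 y := by
  intro δ hδ
  have hlim : Tendsto (fun r : ℝ => κ * (4 * r) ^ 2) (𝓝[>] 0) (𝓝 0) := by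
    have : Continuous fun r : ℝ => κ * (4 * r) ^ 2 := by fun_prop
    simpa using (this.tendsto 0).mono_left nhdsWithin_le_nhds
  obtain ⟨r, hr, hr0⟩ := ((hlim.eventually_le_const (by positivity : 0 < min 1 (δ / 9))).and
    self_mem_nhdsWithin).exists
  refine ⟨Metric.ball y r, Metric.ball_mem_nhds y hr0, ?_⟩
  exact (hG.almostUniformlyConvexOn_ball (min_le_left 1 (δ / 9)) hr y).mono
    (by linarith [min_le_right 1 (δ / 9)])

end ProxFirm

namespace ProxFirm

variable {G : Type*} [MetricSpace G] {p c : ℝ}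

/-! ### Almost firm steps towards a point -/

/-- The step from `x` to `z` is almost firm towards `y`, with weight `m` and violation `ε`. At a
fixed point `y` of `T`, the inequality of almost α-firm nonexpansiveness says this about the steps
from `x` to `T x`. -/
def IsFirmStep (p m ε : ℝ) (x z y : G) : Prop :=
  dist z y ^ p + m * dist z x ^ p ≤ (1 + ε) * dist x y ^ p

theorem IsFirmStep.mono {m m' ε ε' : ℝ} {x z y : G} (h : IsFirmStep p m ε x z y) (hm : m' ≤ m)
    (hε : ε ≤ ε') : IsFirmStep p m' ε' x z y :=
  calc dist z y ^ p + m' * dist z x ^ p ≤ dist z y ^ p + m * dist z x ^ p := by gcongr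
    _ ≤ (1 + ε) * dist x y ^ p := h
    _ ≤ (1 + ε') * dist x y ^ p := by gcongr

theorem IsFirmStep.rpow_dist_le {m ε : ℝ} (hm : 0 ≤ m) {x z y : G} (h : IsFirmStep p m ε x z y) :
    dist z y ^ p ≤ (1 + ε) * dist x y ^ p :=
  (le_add_of_nonneg_right (by positivity)).trans h

theorem IsFirmStep.trans (hG : WeightedTriangleIneq p c G) {m n ε δ : ℝ} (hm : 0 < m) (hn : 0 < n)
    (hδ : 0 ≤ δ) {x z w y : G} (hxz : IsFirmStep p m ε x z y) (hzw : IsFirmStep p n δ z w y) :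
    IsFirmStep p (c / 2 * (m * n / (m + n))) (ε + δ + ε * δ) x w y := by
  have htri := hG m hm n hn x z w
  have hslack : 0 ≤ δ * (m * dist z x ^ p) := by positivity
  have hscaled := mul_le_mul_of_nonneg_left hxz (by linarith : 0 ≤ 1 + δ)
  rw [IsFirmStep] at hzw ⊢
  rw [dist_comm w x]
  rw [dist_comm x z, dist_comm z w] at htri
  linarith

theorem IsFirmStep.relax {δ : ℝ} {D : Set G} (hD : AlmostUniformlyConvexOn p c δ D)
    {m ε e β : ℝ} (hβ : β ∈ Ioc (0 : ℝ) 1) {x z y : G} (hx : x ∈ D) (hz : z ∈ D) (hy : y ∈ D)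
    (h : IsFirmStep p m ε x z y)
    (he : δ * (dist y x ^ p + dist y z ^ p + dist x z ^ p) ≤ e * dist x y ^ p)
    {γ : ℝ → G} (hγ : IsGeodesic γ x z) :
    IsFirmStep p ((m + c / 2 * (1 - β)) / β ^ (p - 1)) (β * ε + e) x (γ β) y := by
  have hβ' := Ioc_subset_Icc_self hβ
  have hconv := hD x hx z hz y hy γ hγ β hβ'
  have hfirm := mul_le_mul_of_nonneg_left h hβ.1.le
  have hweight : (m + c / 2 * (1 - β)) / β ^ (p - 1) * dist (γ β) x ^ p
      = (m + c / 2 * (1 - β)) * (β * dist x z ^ p) := by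
    have hβp : β ^ p = β ^ (p - 1) * β := by
      rw [← Real.rpow_add_one hβ.1.ne', sub_add_cancel]
    have := (Real.rpow_pos_of_pos hβ.1 (p - 1)).ne'
    rw [hγ.dist_left hβ', Real.mul_rpow hβ.1.le dist_nonneg, hβp]
    field_simp
  rw [IsFirmStep, hweight]
  rw [dist_comm y (γ β), dist_comm y x, dist_comm y z] at hconv
  rw [dist_comm y x, dist_comm y z] at he
  rw [dist_comm z x] at hfirm
  linarith

theorem IsNearestAlong.isFirmStep (hG : IsPUniformlyConvex p c G) (hc1 : 1 < c) (hc2 : c ≤ 2)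
    {x u y : G} (h : IsNearestAlong x u y) : IsFirmStep p (1 / (c - 1)) (epsC c) x u y := by
  have hc0 : 0 < c - 1 := sub_pos.2 hc1
  have heps : 1 + epsC c = 1 / (c - 1) := by
    rw [epsC]
    field_simp
    ring
  have hnear := h.rpow_dist_add_le hG
  have hmul : (c - 1) * dist u y ^ p ≤ c / 2 * dist u y ^ p := by
    gcongr
    linarith
  rw [IsFirmStep, heps]
  refine le_of_mul_le_mul_left ?_ hc0
  rw [mul_add, ← mul_assoc, ← mul_assoc, mul_one_div_cancel hc0.ne', dist_comm u x]
  linarith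

theorem IsNearestAlong.isFirmStep_of_isSymmPerp (hG : IsPUniformlyConvex p c G)
    (hS : IsSymmPerp G) {x u y : G} (h : IsNearestAlong x u y) :
    IsFirmStep p (c / 2) 0 x u y := by
  have := (h.symm hG.isGeodesicSpace hS).rpow_dist_add_le hG
  rwa [IsFirmStep, add_zero, one_mul, dist_comm u y, dist_comm x y]

theorem IsNearestAlong.isFirmStep_of_almostUniformlyConvexOn {t : ℝ} {D : Set G}
    (hD : AlmostUniformlyConvexOn p 2 (t ^ 2) D) (hp : 0 < p) (hG : IsGeodesicSpace G)
    (ht : t ∈ Ioc (0 : ℝ) 1) {x u y : G} (hx : x ∈ D) (hu : u ∈ D) (hy : y ∈ D)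
    (h : IsNearestAlong x u y) : IsFirmStep p 1 (t * (2 + 2 * 2 ^ p)) x u y := by
  have hnear := hD.rpow_dist_add_le hp.le hG hx hu hy h ht
  have hxu : dist x u ^ p ≤ dist x y ^ p := by
    gcongr
    exact h.dist_le hG
  have huy : dist u y ^ p ≤ 2 ^ p * dist x y ^ p := by
    rw [← Real.mul_rpow two_pos.le dist_nonneg]
    gcongr
    exact h.dist_le_two_mul hG
  have hsum := mul_le_mul_of_nonneg_left
    (by linarith : dist u y ^ p + (dist x u ^ p + dist x y ^ p + dist u y ^ p)
      ≤ (2 + 2 * 2 ^ p) * dist x y ^ p) ht.1.le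
  rw [sq, mul_div_cancel_right₀ t ht.1.ne'] at hnear
  rw [IsFirmStep, dist_comm u x]
  linarith

/-! ### The constants -/

/-- The weight of the transport discrepancy in the definition of α-firm nonexpansiveness. -/
noncomputable def firmWeight (α : ℝ) : ℝ := (1 - α) / α

/-- The constant of the relaxation `βT ⊕ (1-β)Id` of a mapping `T` with constant `a`. It is
`alphaKM p c β` for `a = alphaC c` and `alphaKMAsymp p β` for `a = 1/2`. -/
noncomputable def alphaRelax (p a β : ℝ) : ℝ := a * β ^ (p - 1) / (a * β ^ (p - 1) - a * β + 1)

theorem firmWeight_pos {α : ℝ} (hα : α ∈ Ioo (0 : ℝ) 1) : 0 < firmWeight α :=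
  div_pos (sub_pos.2 hα.2) hα.1

theorem div_add_mem_Ioo {m n : ℝ} (hm : 0 < m) (hn : 0 < n) : n / (m + n) ∈ Ioo (0 : ℝ) 1 :=
  ⟨by positivity, (div_lt_one (by positivity)).2 (lt_add_of_pos_left n hm)⟩

theorem firmWeight_div_add {m n : ℝ} (hm : 0 < m) (hn : 0 < n) :
    firmWeight (n / (m + n)) = m / n := by
  rw [firmWeight]
  field_simp
  ring

theorem epsC_nonneg (hc1 : 1 < c) (hc2 : c ≤ 2) : 0 ≤ epsC c :=
  div_nonneg (sub_nonneg.2 hc2) (sub_pos.2 hc1).le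

theorem alphaC_eq (c : ℝ) : alphaC c = c * (c - 1) / (2 + c * (c - 1)) := by
  rw [alphaC, add_comm]

theorem alphaC_mem_Ioo (hc1 : 1 < c) : alphaC c ∈ Ioo (0 : ℝ) 1 := by
  rw [alphaC_eq]
  exact div_add_mem_Ioo two_pos (mul_pos (by linarith) (by linarith))

theorem firmWeight_alphaC (hc1 : 1 < c) : firmWeight (alphaC c) = 2 / (c * (c - 1)) := by
  rw [alphaC_eq, firmWeight_div_add two_pos (mul_pos (by linarith) (by linarith))]

theorem half_mem_Ioo : (1 / 2 : ℝ) ∈ Ioo (0 : ℝ) 1 := by norm_num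

theorem firmWeight_half : firmWeight (1 / 2) = 1 := by norm_num [firmWeight]

section Composition

variable {a b : ℝ} (hc : 0 < c) (ha : a ∈ Ioo (0 : ℝ) 1) (hb : b ∈ Ioo (0 : ℝ) 1)

theorem alphaComp_eq (c a b : ℝ) : alphaComp c a b = (a * (1 - b) + b * (1 - a)) /
    (c / 2 * ((1 - a) * (1 - b)) + (a * (1 - b) + b * (1 - a))) := by
  rw [alphaComp]
  congr 1 <;> ring

include hc ha hb

theorem alphaComp_mem_Ioo : alphaComp c a b ∈ Ioo (0 : ℝ) 1 := by
  have ha' := sub_pos.2 ha.2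
  have hb' := sub_pos.2 hb.2
  have ha0 := ha.1
  have hb0 := hb.1
  rw [alphaComp_eq]
  exact div_add_mem_Ioo (by positivity) (by positivity)

theorem firmWeight_alphaComp : firmWeight (alphaComp c a b)
    = c / 2 * (firmWeight a * firmWeight b / (firmWeight a + firmWeight b)) := by
  have ha' := sub_pos.2 ha.2
  have hb' := sub_pos.2 hb.2
  have ha0 := ha.1
  have hb0 := hb.1
  rw [alphaComp_eq, firmWeight_div_add (by positivity) (by positivity), firmWeight, firmWeight]
  field_simp
  ring

end Composition

section Relaxation

variable {a β : ℝ} (ha : a ∈ Ioo (0 : ℝ) 1) (hβ : β ∈ Ioc (0 : ℝ) 1)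

theorem alphaRelax_eq (p a β : ℝ) :
    alphaRelax p a β = a * β ^ (p - 1) / (1 - a * β + a * β ^ (p - 1)) := by
  rw [alphaRelax]
  congr 1
  ring

include ha hβ

theorem mul_lt_one_of_mem_Ioo_of_mem_Ioc : a * β < 1 :=
  mul_lt_one_of_nonneg_of_lt_one_left ha.1.le ha.2 hβ.2

theorem alphaRelax_mem_Ioo (p : ℝ) : alphaRelax p a β ∈ Ioo (0 : ℝ) 1 := by
  rw [alphaRelax_eq]
  exact div_add_mem_Ioo (sub_pos.2 (mul_lt_one_of_mem_Ioo_of_mem_Ioc ha hβ))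
    (mul_pos ha.1 (Real.rpow_pos_of_pos hβ.1 _))

theorem firmWeight_alphaRelax (p : ℝ) :
    firmWeight (alphaRelax p a β) = (firmWeight a + 1 - β) / β ^ (p - 1) := by
  have hβp := Real.rpow_pos_of_pos hβ.1 (p - 1)
  have ha0 := ha.1
  rw [alphaRelax_eq, firmWeight_div_add (sub_pos.2 (mul_lt_one_of_mem_Ioo_of_mem_Ioc ha hβ))
    (mul_pos ha0 hβp), firmWeight]
  field_simp
  ring

end Relaxation

theorem alphaKM_eq_alphaRelax (p c β : ℝ) : alphaKM p c β = alphaRelax p (alphaC c) β := rfl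

theorem alphaKMAsymp_eq_alphaRelax (p β : ℝ) : alphaKMAsymp p β = alphaRelax p (1 / 2) β := by
  rw [alphaKMAsymp, alphaRelax, ← mul_div_mul_left _ _ (one_half_pos (α := ℝ)).ne']
  congr 1
  ring

theorem alphaComp_self {a : ℝ} (ha : a ≠ 1) :
    alphaComp c a a = 2 * a / (c / 2 * (1 - a) + 2 * a) := by
  rw [alphaComp_eq, ← mul_div_mul_right (2 * a) _ (sub_ne_zero.2 ha.symm)]
  congr 1 <;> ring

theorem alphaComp_alphaC_alphaC (hc1 : 1 < c) :
    alphaComp c (alphaC c) (alphaC c) = 2 * (c - 1) / (2 * c - 1) := by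
  have hc0 : 0 < c - 1 := sub_pos.2 hc1
  have : 0 < c * (c - 1) + 2 := by nlinarith
  have hden' : 2 * c - 1 ≠ 0 := by linarith
  have hcompl : 1 - alphaC c = 2 / (c * (c - 1) + 2) := by
    rw [alphaC]
    field_simp
    ring
  rw [alphaComp_self (alphaC_mem_Ioo hc1).2.ne, hcompl, alphaC]
  have hsum : c / 2 * (2 / (c * (c - 1) + 2)) + 2 * (c * (c - 1) / (c * (c - 1) + 2))
      = c * (2 * c - 1) / (c * (c - 1) + 2) := by
    field_simp
    ring
  rw [hsum]
  field_simp

theorem alphaComp_half (hc : 0 ≤ c) {a : ℝ} (ha : a ≤ 1) :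
    alphaComp c a (1 / 2) = 1 / (c / 2 * (1 - a) + 1) := by
  have : 0 < c / 2 * (1 - a) + 1 := by
    have := sub_nonneg.2 ha
    positivity
  have hden : c / 2 * ((1 - a) * (1 - 1 / 2)) + (a * (1 - 1 / 2) + 1 / 2 * (1 - a))
      = (c / 2 * (1 - a) + 1) / 2 := by ring
  rw [alphaComp_eq, hden]
  field_simp
  ring

theorem alphaComp_two_half {a : ℝ} (ha : a ≤ 1) : alphaComp 2 a (1 / 2) = 1 / (2 - a) := by
  rw [alphaComp_half two_pos.le ha]
  congr 1
  ring

theorem epsC_add_epsC_add_mul (hc1 : 1 < c) :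
    epsC c + epsC c + epsC c * epsC c = 1 / (c - 1) ^ 2 - 1 := by
  have h0 : c - 1 ≠ 0 := (sub_pos.2 hc1).ne'
  rw [epsC]
  field_simp
  ring

end ProxFirm

namespace ProxFirm

variable {G : Type*} [MetricSpace G] {p c r : ℝ} {T S : G → G} {y : G} {a b : ℝ}

/-! ### Firmness at fixed points -/

theorem psi_of_isFixedPt (hp : p ≠ 0) (hy : T y = y) (r : ℝ) (x : G) :
    psi p r T x y = r / 2 * dist (T x) x ^ p := by
  rw [psi, hy, dist_self, Real.zero_rpow hp]
  ring

theorem firmIneq_iff_isFirmStep (hp : p ≠ 0) (hy : T y = y) {ε : ℝ} {x : G} :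
    FirmIneq p r T a ε x y ↔ IsFirmStep p (r / 2 * firmWeight a) ε x (T x) y := by
  rw [FirmIneq, IsFirmStep, psi_of_isFixedPt hp hy, hy, firmWeight, le_sub_iff_add_le,
    ← mul_assoc, mul_comm (r / 2)]

theorem almostFirmAt_iff (hp : p ≠ 0) (hy : T y = y) {D : Set G} {ε : ℝ} :
    AlmostFirmAt p r T D y a ε ↔ a ∈ Ioo (0 : ℝ) 1 ∧ 0 ≤ ε ∧ y ∈ D ∧
      ∀ x ∈ D, IsFirmStep p (r / 2 * firmWeight a) ε x (T x) y := by
  simp only [AlmostFirmAt, firmIneq_iff_isFirmStep hp hy, mem_Ioo, and_assoc]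

theorem asympFirmAt_iff (hp : p ≠ 0) (hy : T y = y) :
    AsympFirmAt p r T y a ↔ a ∈ Ioo (0 : ℝ) 1 ∧
      ∀ ε > 0, ∀ᶠ x in 𝓝 y, IsFirmStep p (r / 2 * firmWeight a) ε x (T x) y := by
  simp only [AsympFirmAt, firmIneq_iff_isFirmStep hp hy, eventually_iff_exists_mem, mem_Ioo,
    and_assoc]

theorem AsympFirmAt.exists_almostFirmAt (hT : AsympFirmAt p r T y a) {ε : ℝ} (hε : 0 < ε) :
    ∃ D ∈ 𝓝 y, AlmostFirmAt p r T D y a ε := by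
  obtain ⟨ha0, ha1, h⟩ := hT
  obtain ⟨D, hD, hfirm⟩ := h ε hε
  exact ⟨D, hD, ha0, ha1, hε.le, mem_of_mem_nhds hD, hfirm⟩

theorem AsympFirmAt.tendsto (hp : 0 < p) (hr : 0 ≤ r) (hy : T y = y) (hT : AsympFirmAt p r T y a) :
    Tendsto T (𝓝 y) (𝓝 y) := by
  obtain ⟨ha, hfirm⟩ := (asympFirmAt_iff hp.ne' hy).1 hT
  have hweight : 0 ≤ r / 2 * firmWeight a := mul_nonneg (by positivity) (firmWeight_pos ha).le
  have hdist : ∀ᶠ x in 𝓝 y, dist (T x) y ≤ 2 ^ p⁻¹ * dist x y := by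
    filter_upwards [hfirm 1 one_pos] with x hx
    have hle := hx.rpow_dist_le hweight
    rw [one_add_one_eq_two] at hle
    rwa [← Real.rpow_le_rpow_iff dist_nonneg (by positivity) hp,
      Real.mul_rpow (by positivity) dist_nonneg, Real.rpow_inv_rpow two_pos.le hp.ne']
  have hlim : Tendsto (fun x => 2 ^ p⁻¹ * dist x y) (𝓝 y) (𝓝 0) := by
    have : Continuous fun x => 2 ^ p⁻¹ * dist x y := by fun_prop
    simpa only [dist_self, mul_zero] using this.tendsto y
  exact tendsto_iff_dist_tendsto_zero.2
    (squeeze_zero' (Eventually.of_forall fun _ => dist_nonneg) hdist hlim)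

/-! ### Compositions -/

theorem isFirmStep_comp (hG : WeightedTriangleIneq p c G) (hc : 0 < c) (hr : 0 < r)
    (ha : a ∈ Ioo (0 : ℝ) 1) (hb : b ∈ Ioo (0 : ℝ) 1) {ε δ : ℝ} (hδ : 0 ≤ δ) {x z w : G}
    (hxz : IsFirmStep p (r / 2 * firmWeight a) ε x z y)
    (hzw : IsFirmStep p (r / 2 * firmWeight b) δ z w y) :
    IsFirmStep p (r / 2 * firmWeight (alphaComp c a b)) (ε + δ + ε * δ) x w y := by
  have hka := firmWeight_pos ha
  have hkb := firmWeight_pos hb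
  refine (hxz.trans hG (by positivity) (by positivity) hδ hzw).mono (le_of_eq ?_) le_rfl
  rw [firmWeight_alphaComp hc ha hb]
  field_simp

theorem AlmostFirmAt.comp (hp : p ≠ 0) (hG : WeightedTriangleIneq p c G) (hc : 0 < c) (hr : 0 < r)
    {D E : Set G} {ε δ : ℝ} (hTy : T y = y) (hSy : S y = y) (hDE : MapsTo T D E)
    (hT : AlmostFirmAt p r T D y a ε) (hS : AlmostFirmAt p r S E y b δ) :
    AlmostFirmAt p r (S ∘ T) D y (alphaComp c a b) (ε + δ + ε * δ) := by
  obtain ⟨ha, hε, hyD, hT⟩ := (almostFirmAt_iff hp hTy).1 hT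
  obtain ⟨hb, hδ, -, hS⟩ := (almostFirmAt_iff hp hSy).1 hS
  refine (almostFirmAt_iff hp (by rw [Function.comp_apply, hTy, hSy])).2
    ⟨alphaComp_mem_Ioo hc ha hb, by positivity, hyD, fun x hx => ?_⟩
  exact isFirmStep_comp hG hc hr ha hb hδ (hT x hx) (hS _ (hDE hx))

theorem AsympFirmAt.comp (hp : 0 < p) (hG : WeightedTriangleIneq p c G) (hc : 0 < c) (hr : 0 < r)
    (hTy : T y = y) (hSy : S y = y) (hT : AsympFirmAt p r T y a) (hS : AsympFirmAt p r S y b) :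
    AsympFirmAt p r (S ∘ T) y (alphaComp c a b) := by
  have hlim := hT.tendsto hp hr.le hTy
  obtain ⟨ha, hT⟩ := (asympFirmAt_iff hp.ne' hTy).1 hT
  obtain ⟨hb, hS⟩ := (asympFirmAt_iff hp.ne' hSy).1 hS
  refine (asympFirmAt_iff hp.ne' (by rw [Function.comp_apply, hTy, hSy])).2
    ⟨alphaComp_mem_Ioo hc ha hb, fun ε hε => ?_⟩
  obtain ⟨δ, hδ, hδ1, hδε⟩ : ∃ δ > 0, δ ≤ 1 ∧ δ ≤ ε / 3 :=
    ⟨min 1 (ε / 3), by positivity, min_le_left _ _, min_le_right _ _⟩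
  filter_upwards [hT δ hδ, hlim.eventually (hS δ hδ)] with x hx hTx
  exact (isFirmStep_comp hG hc hr ha hb hδ.le hx hTx).mono le_rfl (by nlinarith)

/-! ### Relaxations -/

theorem isFirmStep_km {δ e ε β : ℝ} {D : Set G} (hD : AlmostUniformlyConvexOn p c δ D)
    (hG : IsGeodesicSpace G) (hr : r ≤ c) (ha : a ∈ Ioo (0 : ℝ) 1) (hβ : β ∈ Ioc (0 : ℝ) 1)
    {x : G} (hx : x ∈ D) (hSx : S x ∈ D) (hy : y ∈ D)
    (h : IsFirmStep p (r / 2 * firmWeight a) ε x (S x) y)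
    (he : δ * (dist y x ^ p + dist y (S x) ^ p + dist x (S x) ^ p) ≤ e * dist x y ^ p) :
    IsFirmStep p (r / 2 * firmWeight (alphaRelax p a β)) (β * ε + e) x (km β S x) y := by
  obtain ⟨γ, hγ, hγβ⟩ := exists_isGeodesic_geoComb_eq hG β x (S x)
  rw [km, hγβ]
  refine (h.relax hD hβ hx hSx hy he hγ).mono ?_ le_rfl
  have hβp := Real.rpow_pos_of_pos hβ.1 (p - 1)
  rw [firmWeight_alphaRelax ha hβ, ← mul_div_assoc, add_sub_assoc, mul_add]
  have hβ' := sub_nonneg.2 hβ.2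
  gcongr

theorem AlmostFirmAt.km (hG : IsPUniformlyConvex p c G) (hr : r ≤ c) {D : Set G} {ε β : ℝ}
    (hβ : β ∈ Ioc (0 : ℝ) 1) (hSy : S y = y) (hS : AlmostFirmAt p r S D y a ε) :
    AlmostFirmAt p r (km β S) D y (alphaRelax p a β) (β * ε) := by
  have hp := hG.exponent_pos.ne'
  have hgeo := hG.isGeodesicSpace
  obtain ⟨ha, hε, hyD, hS⟩ := (almostFirmAt_iff hp hSy).1 hS
  refine (almostFirmAt_iff hp (km_eq_self hgeo (Ioc_subset_Icc_self hβ) hSy)).2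
    ⟨alphaRelax_mem_Ioo ha hβ p, mul_nonneg hβ.1.le hε, hyD, fun x hx => ?_⟩
  simpa only [add_zero] using isFirmStep_km (e := 0) hG.almostUniformlyConvexOn hgeo hr ha hβ
    (mem_univ x) (mem_univ (S x)) (mem_univ y) (hS x hx) (by rw [zero_mul, zero_mul])

theorem IsFirmStep.sum_rpow_dist_le {m ε : ℝ} (hm : 0 < m) (hε : ε ≤ 1) {x z : G}
    (h : IsFirmStep p m ε x z y) :
    dist y x ^ p + dist y z ^ p + dist x z ^ p ≤ (3 + 2 / m) * dist x y ^ p := by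
  have h2 : dist z y ^ p + m * dist z x ^ p ≤ 2 * dist x y ^ p :=
    (h.mono le_rfl hε).trans_eq (by rw [one_add_one_eq_two])
  have hzy : 0 ≤ dist z y ^ p := by positivity
  have hzx : 0 ≤ m * dist z x ^ p := by positivity
  have hzx_le : dist z x ^ p ≤ 2 / m * dist x y ^ p := by
    rw [div_mul_eq_mul_div, le_div_iff₀' hm]
    linarith
  rw [dist_comm y x, dist_comm y z, dist_comm x z]
  linarith

theorem AsympFirmAt.km (hp : 0 < p) (hG : IsGeodesicSpace G) (hU : AsympUniformlyConvexAt p c y)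
    (hr : r ∈ Ioc 0 c) {β : ℝ} (hβ : β ∈ Ioc (0 : ℝ) 1) (hSy : S y = y)
    (hS : AsympFirmAt p r S y a) : AsympFirmAt p r (km β S) y (alphaRelax p a β) := by
  have hlim := hS.tendsto hp hr.1.le hSy
  obtain ⟨ha, hS⟩ := (asympFirmAt_iff hp.ne' hSy).1 hS
  refine (asympFirmAt_iff hp.ne' (km_eq_self hG (Ioc_subset_Icc_self hβ) hSy)).2
    ⟨alphaRelax_mem_Ioo ha hβ p, fun ε hε => ?_⟩
  set m := r / 2 * firmWeight a
  have hm : 0 < m := mul_pos (half_pos hr.1) (firmWeight_pos ha)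
  obtain ⟨η, hη, hη1, hηε⟩ : ∃ η > 0, η ≤ 1 ∧ η ≤ ε / 2 :=
    ⟨min 1 (ε / 2), by positivity, min_le_left _ _, min_le_right _ _⟩
  obtain ⟨D, hD, hconv⟩ := hU (ε / 2 / (3 + 2 / m)) (by positivity)
  filter_upwards [hS η hη, hD, hlim hD] with x hx hxD hSxD
  have herror := mul_le_mul_of_nonneg_left (hx.sum_rpow_dist_le hm hη1)
    (by positivity : 0 ≤ ε / 2 / (3 + 2 / m))
  rw [← mul_assoc, div_mul_cancel₀ _ (by positivity)] at herror
  refine (isFirmStep_km hconv hG hr.2 ha hβ hxD hSxD (mem_of_mem_nhds hD) hx herror).mono le_rfl ?_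
  linarith [mul_le_of_le_one_left hη.le hβ.2]

/-! ### Mappings to nearest points -/

theorem IsNearestMapAt.km_map_eq (hG : IsGeodesicSpace G) {β : ℝ} (hβ : β ∈ Ioc (0 : ℝ) 1)
    (hT : IsNearestMapAt T y) : km β T y = y :=
  km_eq_self hG (Ioc_subset_Icc_self hβ) (hT.map_eq hG)

theorem IsNearestMapAt.almostFirmAt (hG : IsPUniformlyConvex p c G) (hc1 : 1 < c) (hc2 : c ≤ 2)
    (hT : IsNearestMapAt T y) : AlmostFirmAt p c T univ y (alphaC c) (epsC c) := by
  have hweight : c / 2 * firmWeight (alphaC c) = 1 / (c - 1) := by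
    rw [firmWeight_alphaC hc1]
    field_simp
  refine (almostFirmAt_iff hG.exponent_pos.ne' (hT.map_eq hG.isGeodesicSpace)).2
    ⟨alphaC_mem_Ioo hc1, epsC_nonneg hc1 hc2, mem_univ y, fun x _ => ?_⟩
  rw [hweight]
  exact (hT x).isFirmStep hG hc1 hc2

theorem IsNearestMapAt.almostFirmAt_of_isSymmPerp (hG : IsPUniformlyConvex p c G)
    (hsymm : IsSymmPerp G) (hT : IsNearestMapAt T y) : AlmostFirmAt p c T univ y (1 / 2) 0 := by
  refine (almostFirmAt_iff hG.exponent_pos.ne' (hT.map_eq hG.isGeodesicSpace)).2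
    ⟨half_mem_Ioo, le_rfl, mem_univ y, fun x _ => ?_⟩
  rw [firmWeight_half, mul_one]
  exact (hT x).isFirmStep_of_isSymmPerp hG hsymm

theorem IsNearestMapAt.asympFirmAt (hp : 0 < p) (hG : IsGeodesicSpace G)
    (hU : AsympUniformlyConvexAt p 2 y) (hr : r ≤ 2) (hT : IsNearestMapAt T y) :
    AsympFirmAt p r T y (1 / 2) := by
  refine (asympFirmAt_iff hp.ne' (hT.map_eq hG)).2 ⟨half_mem_Ioo, fun ε hε => ?_⟩
  obtain ⟨t, ht0, ht1, htε⟩ : ∃ t > 0, t ≤ 1 ∧ t ≤ ε / (2 + 2 * 2 ^ p) :=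
    ⟨min 1 (ε / (2 + 2 * 2 ^ p)), by positivity, min_le_left _ _, min_le_right _ _⟩
  obtain ⟨D, hD, hconv⟩ := hU (t ^ 2) (by positivity)
  filter_upwards [hD, hT.tendsto hG hD] with x hx hTx
  refine ((hT x).isFirmStep_of_almostUniformlyConvexOn hconv hp hG ⟨ht0, ht1⟩ hx hTx
    (mem_of_mem_nhds hD)).mono ?_ ((le_div_iff₀ (by positivity)).1 htε)
  rw [firmWeight_half]
  linarith

section PUniformlyConvex

variable (hG : IsPUniformlyConvex p c G) (hc1 : 1 < c) (hc2 : c ≤ 2)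
include hG hc1 hc2

theorem IsNearestMapAt.comp_almostFirmAt {D : Set G} {ε : ℝ} (hS : IsNearestMapAt S y)
    (hTy : T y = y) (hT : AlmostFirmAt p c T D y a ε) :
    AlmostFirmAt p c (S ∘ T) D y (alphaComp c a (alphaC c)) (ε + epsC c + ε * epsC c) :=
  hT.comp hG.exponent_pos.ne' hG.weightedTriangleIneq hG.2.1 hG.2.1 hTy
    (hS.map_eq hG.isGeodesicSpace) (mapsTo_univ T D) (hS.almostFirmAt hG hc1 hc2)

theorem IsNearestMapAt.almostFirmAt_comp (hS : IsNearestMapAt S y) (hT : IsNearestMapAt T y) :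
    AlmostFirmAt p c (S ∘ T) univ y (2 * (c - 1) / (2 * c - 1)) (1 / (c - 1) ^ 2 - 1) := by
  rw [← alphaComp_alphaC_alphaC hc1, ← epsC_add_epsC_add_mul hc1]
  exact hS.comp_almostFirmAt hG hc1 hc2 (hT.map_eq hG.isGeodesicSpace) (hT.almostFirmAt hG hc1 hc2)

variable {β : ℝ} (hβ : β ∈ Ioc (0 : ℝ) 1)
include hβ

theorem IsNearestMapAt.almostFirmAt_km (hT : IsNearestMapAt T y) :
    AlmostFirmAt p c (km β T) univ y (alphaKM p c β) (β * epsC c) := by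
  rw [alphaKM_eq_alphaRelax]
  exact (hT.almostFirmAt hG hc1 hc2).km hG le_rfl hβ (hT.map_eq hG.isGeodesicSpace)

theorem IsNearestMapAt.almostFirmAt_comp_km (hS : IsNearestMapAt S y) (hT : IsNearestMapAt T y) :
    AlmostFirmAt p c (S ∘ km β T) univ y (alphaComp c (alphaKM p c β) (alphaC c))
      ((1 + β) * epsC c + β * epsC c ^ 2) := by
  have hcomp := hS.comp_almostFirmAt hG hc1 hc2 (hT.km_map_eq hG.isGeodesicSpace hβ)
    (hT.almostFirmAt_km hG hc1 hc2 hβ)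
  convert hcomp using 1
  ring

theorem IsNearestMapAt.almostFirmAt_comp_km_of_isSymmPerp (hsymm : IsSymmPerp G)
    (hS : IsNearestMapAt S y) (hT : IsNearestMapAt T y) :
    AlmostFirmAt p c (S ∘ km β T) univ y (1 / (c / 2 * (1 - alphaKM p c β) + 1))
      (epsC c * β) := by
  have hkm := hT.almostFirmAt_km hG hc1 hc2 hβ
  have hcomp := hkm.comp hG.exponent_pos.ne' hG.weightedTriangleIneq hG.2.1 hG.2.1
    (hT.km_map_eq hG.isGeodesicSpace hβ) (hS.map_eq hG.isGeodesicSpace) (mapsTo_univ _ univ)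
    (hS.almostFirmAt_of_isSymmPerp hG hsymm)
  rwa [alphaComp_half hG.2.1.le hkm.2.1.le, add_zero, mul_zero, add_zero, mul_comm β] at hcomp

end PUniformlyConvex

section AsympUniformlyConvex

theorem IsNearestMapAt.asympFirmAt_km (hp : 0 < p) (hG : IsGeodesicSpace G)
    (hU : AsympUniformlyConvexAt p 2 y) (hr : r ∈ Ioc (0 : ℝ) 2) {β : ℝ} (hβ : β ∈ Ioc (0 : ℝ) 1)
    (hT : IsNearestMapAt T y) : AsympFirmAt p r (km β T) y (alphaKMAsymp p β) := by
  rw [alphaKMAsymp_eq_alphaRelax]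
  exact (hT.asympFirmAt hp hG hU hr.2).km hp hG hU hr hβ (hT.map_eq hG)

variable (hG : IsGeodesicSpace G) (hU : AsympUniformlyConvexAt 2 2 y) (hr : r ∈ Ioc (0 : ℝ) 2)
include hG hU hr

theorem IsNearestMapAt.comp_asympFirmAt (hS : IsNearestMapAt S y) (hTy : T y = y)
    (hT : AsympFirmAt 2 r T y a) : AsympFirmAt 2 r (S ∘ T) y (1 / (2 - a)) := by
  rw [← alphaComp_two_half hT.2.1.le]
  exact hT.comp two_pos weightedTriangleIneq_two two_pos hr.1 hTy (hS.map_eq hG)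
    (hS.asympFirmAt two_pos hG hU hr.2)

theorem IsNearestMapAt.asympFirmAt_comp (hS : IsNearestMapAt S y) (hT : IsNearestMapAt T y) :
    AsympFirmAt 2 r (S ∘ T) y (2 / 3) := by
  convert hS.comp_asympFirmAt hG hU hr (hT.map_eq hG) (hT.asympFirmAt two_pos hG hU hr.2) using 1
  norm_num

theorem IsNearestMapAt.asympFirmAt_comp_km {β : ℝ} (hβ : β ∈ Ioc (0 : ℝ) 1)
    (hS : IsNearestMapAt S y) (hT : IsNearestMapAt T y) :
    AsympFirmAt 2 r (S ∘ km β T) y (1 / (2 - alphaKMAsymp 2 β)) :=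
  hS.comp_asympFirmAt hG hU hr (hT.km_map_eq hG hβ) (hT.asympFirmAt_km two_pos hG hU hr hβ)

end AsympUniformlyConvex

end ProxFirm

theorem proposition4p3 {G : Type*} [MetricSpace G] [CompleteSpace G] (p c : ℝ)
    (hG : ProxFirm.IsPUniformlyConvex p c G) (hc1 : 1 < c) (hc2 : c ≤ 2)
    (f g : G → EReal) (hf : ProxFirm.IsProperConvexLsc f) (hg : ProxFirm.IsProperConvexLsc g)
    (hfg : (ProxFirm.argmin f ∩ ProxFirm.argmin g).Nonempty) :
    -- (i) composition of two proximal mappings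
    (∀ l₁ > 0, ∀ l₂ > 0, ∀ y ∈ ProxFirm.argmin f ∩ ProxFirm.argmin g,
      ProxFirm.AlmostFirmAt p c (ProxFirm.prox p l₂ f ∘ ProxFirm.prox p l₁ g) univ y
        (2 * (c - 1) / (2 * c - 1)) (1 / (c - 1) ^ 2 - 1) ∧
      (p = 2 → ∀ κ > 0, ProxFirm.IsCAT κ G → ∀ c' ∈ Ioc (0 : ℝ) 2,
        ProxFirm.AsympFirmAt p c' (ProxFirm.prox p l₂ f ∘ ProxFirm.prox p l₁ g) y (2 / 3))) ∧
    -- (ii) composition of a proximal mapping with an asymptotically firm mapping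
    (∀ l > 0, ∀ (T₀ : G → G) (α₀ : ℝ),
      ((∀ y ∈ ProxFirm.argmin f ∩ Function.fixedPoints T₀, ProxFirm.AsympFirmAt p c T₀ y α₀) →
        ∀ y ∈ ProxFirm.argmin f ∩ Function.fixedPoints T₀,
          (∀ (D : Set G) (ε₀ : ℝ), ProxFirm.AlmostFirmAt p c T₀ D y α₀ ε₀ →
            ProxFirm.AlmostFirmAt p c (ProxFirm.prox p l f ∘ T₀) D y
              (ProxFirm.alphaComp c α₀ (ProxFirm.alphaC c))
              (ε₀ + ProxFirm.epsC c + ε₀ * ProxFirm.epsC c)) ∧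
          (∀ ε₀ > 0, ∃ D ∈ 𝓝 y, ProxFirm.AlmostFirmAt p c T₀ D y α₀ ε₀ ∧
            ProxFirm.AlmostFirmAt p c (ProxFirm.prox p l f ∘ T₀) D y
              (ProxFirm.alphaComp c α₀ (ProxFirm.alphaC c))
              (ε₀ + ProxFirm.epsC c + ε₀ * ProxFirm.epsC c))) ∧
      (p = 2 → ∀ κ > 0, ProxFirm.IsCAT κ G → ∀ c' ∈ Ioc (0 : ℝ) 2,
        (∀ y ∈ ProxFirm.argmin f ∩ Function.fixedPoints T₀,
          ProxFirm.AsympFirmAt p c' T₀ y α₀) →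
        ∀ y ∈ ProxFirm.argmin f ∩ Function.fixedPoints T₀,
          ProxFirm.AsympFirmAt p c' (ProxFirm.prox p l f ∘ T₀) y (1 / (2 - α₀)))) ∧
    -- (iii) Krasnoselski-Mann relaxation of a proximal mapping
    (∀ l > 0, ∀ β ∈ Ioc (0 : ℝ) 1, ∀ y ∈ ProxFirm.argmin f,
      ProxFirm.AlmostFirmAt p c (ProxFirm.km β (ProxFirm.prox p l f)) univ y
        (ProxFirm.alphaKM p c β) (β * ProxFirm.epsC c) ∧
      (p = 2 → ∀ κ > 0, ProxFirm.IsCAT κ G → ∀ c' ∈ Ioc (0 : ℝ) 2,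
        ProxFirm.AsympFirmAt p c' (ProxFirm.km β (ProxFirm.prox p l f)) y
          (ProxFirm.alphaKMAsymp p β))) ∧
    -- (iv) composition of a proximal mapping with a relaxed proximal mapping
    (∀ l₁ > 0, ∀ l₂ > 0, ∀ β ∈ Ioc (0 : ℝ) 1, ∀ y ∈ ProxFirm.argmin f ∩ ProxFirm.argmin g,
      ProxFirm.AlmostFirmAt p c
        (ProxFirm.prox p l₂ f ∘ ProxFirm.km β (ProxFirm.prox p l₁ g)) univ y
        (ProxFirm.alphaComp c (ProxFirm.alphaKM p c β) (ProxFirm.alphaC c))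
        ((1 + β) * ProxFirm.epsC c + β * ProxFirm.epsC c ^ 2) ∧
      (p = 2 → ∀ κ > 0, ProxFirm.IsCAT κ G → ∀ c' ∈ Ioc (0 : ℝ) 2,
        ProxFirm.AsympFirmAt p c'
          (ProxFirm.prox p l₂ f ∘ ProxFirm.km β (ProxFirm.prox p l₁ g)) y
          (1 / (2 - ProxFirm.alphaKMAsymp p β)))) ∧
    -- (v) projected relaxed proximal mapping
    (∀ C : Set G, IsClosed C → ProxFirm.IsGeodConvex C →
      ∀ l > 0, ∀ β ∈ Ioc (0 : ℝ) 1, ∀ y ∈ C ∩ ProxFirm.argmin g,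
      (ProxFirm.IsSymmPerp G →
        ProxFirm.AlmostFirmAt p c
          (ProxFirm.proj C ∘ ProxFirm.km β (ProxFirm.prox p l g)) univ y
          (1 / (c / 2 * (1 - ProxFirm.alphaKM p c β) + 1)) (ProxFirm.epsC c * β)) ∧
      (p = 2 → ∀ κ > 0, ProxFirm.IsCAT κ G → ∀ c' ∈ Ioc (0 : ℝ) 2,
        ProxFirm.AsympFirmAt p c'
          (ProxFirm.proj C ∘ ProxFirm.km β (ProxFirm.prox p l g)) y
          (1 / (2 - ProxFirm.alphaKMAsymp p β)))) := by
  have hgeo := hG.isGeodesicSpace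
  have hF {l : ℝ} (hl : 0 < l) {y : G} (hy : y ∈ ProxFirm.argmin f) :=
    ProxFirm.isNearestMapAt_prox hG hl hf hy
  have hP {l : ℝ} (hl : 0 < l) {y : G} (hy : y ∈ ProxFirm.argmin g) :=
    ProxFirm.isNearestMapAt_prox hG hl hg hy
  refine ⟨fun l₁ hl₁ l₂ hl₂ y hy => ⟨?_, ?_⟩, fun l hl T₀ α₀ => ⟨fun hT₀ y hy => ?_, ?_⟩,
    fun l hl β hβ y hy => ⟨?_, ?_⟩, fun l₁ hl₁ l₂ hl₂ β hβ y hy => ⟨?_, ?_⟩,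
    fun C hC hconv l hl β hβ y hy => ?_⟩
  · exact (hF hl₂ hy.1).almostFirmAt_comp hG hc1 hc2 (hP hl₁ hy.2)
  · rintro rfl κ - hκ r hr
    exact (hF hl₂ hy.1).asympFirmAt_comp hgeo (hκ.asympUniformlyConvexAt y) hr (hP hl₁ hy.2)
  · have hcomp := fun D ε₀ =>
      (hF hl hy.1).comp_almostFirmAt (D := D) (a := α₀) (ε := ε₀) hG hc1 hc2 hy.2
    refine ⟨hcomp, fun ε₀ hε₀ => ?_⟩
    obtain ⟨D, hD, hT⟩ := (hT₀ y hy).exists_almostFirmAt hε₀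
    exact ⟨D, hD, hT, hcomp D ε₀ hT⟩
  · rintro rfl κ - hκ r hr hT₀ y hy
    exact (hF hl hy.1).comp_asympFirmAt hgeo (hκ.asympUniformlyConvexAt y) hr hy.2 (hT₀ y hy)
  · exact (hF hl hy).almostFirmAt_km hG hc1 hc2 hβ
  · rintro rfl κ - hκ r hr
    exact (hF hl hy).asympFirmAt_km two_pos hgeo (hκ.asympUniformlyConvexAt y) hr hβ
  · exact (hF hl₂ hy.1).almostFirmAt_comp_km hG hc1 hc2 hβ (hP hl₁ hy.2)
  · rintro rfl κ - hκ r hr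
    exact (hF hl₂ hy.1).asympFirmAt_comp_km hgeo (hκ.asympUniformlyConvexAt y) hr hβ (hP hl₁ hy.2)
  · have hproj := ProxFirm.isNearestMapAt_proj hG hC hconv hy.1
    refine ⟨fun hsymm => hproj.almostFirmAt_comp_km_of_isSymmPerp hG hc1 hc2 hβ hsymm (hP hl hy.2),
      ?_⟩
    rintro rfl κ - hκ r hr
    exact hproj.asympFirmAt_comp_km hgeo (hκ.asympUniformlyConvexAt y) hr hβ (hP hl hy.2)
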